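/- Let $r\ge 2$ and $t\ge 2$. Write $K_r^{+}(t)$ for the graph obtained from the complete $r$-partite graph with all vertex classes of size $t$ by adding one edge inside the first class. For integers $k\ge 3$ and $\ell\ge (k-1)!$, let $\mathcal{G}_\ell^k$ be the following family of graphs. Let $\pi_1,\dots,\pi_{(k-1)!}$ be an enumeration of all permutations of $\{1,\dots,k-1\}$, and let $n_i^s$ ($1\le i\le \ell$, $1\le s\le k-1$) be non-negative integers such that - $n_i^{\pi_i(1)}\ge n_i^{\pi_i(2)}\ge\dots\ge n_i^{\pi_i(k-1)}$ for $1\le i\le (k-1)!$, - $n_i^1=n_i^2=\dots=n_i^{k-1}>0$ for $(k-1)!<i\le \ell$, - $\sum_{s} n_i^s>0$ for $1\le i\le \ell$. Take the graph with vertex set $\{(i,s,t): 1\le i\le \ell,\ 1\le s\le k-1,\ 1\le t\le n_i^s\}$ in which $(i,s,t)$ and $(i',s',t')$ are adjacent if and only if $i\ne i'$ and $s\ne s'$. The family $\mathcal{G}_\ell^k$ consists of all graphs obtained from such graphs by removing some (possibly no) edges of the form $(i,s,t)(i',s',t')$ with $1\le i<i'\le (k-1)!$. **Theorem.** Let $k$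 and $\ell$ be integers with $k\ge 3$ and $\ell\ge e^{4k^{(k+6)k}}$. Let $G$ be a finite simple graph on $n$ vertices whose vertex set is partitioned into $\ell$ non-empty independent sets $V_1,\dots,V_\ell$, all of the same size, such that $$d(V_i,V_j):=\frac{e(V_i,V_j)}{|V_i|\,|V_j|}\ \ge\ \frac{k-2}{k-1}\qquad\text{for all } i\ne j.$$ Then either $G$ is isomorphic to a graph in $\mathcal{G}_\ell^k$, or $G$ contains a (not necessarily induced) copy of $K_{k-1}^{+}(\lfloor c\ln n\rfloor)$, where $c=k^{-(k+6)k}/2$. -/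

import Mathlib

/-- The `i`-th vertex class `V_i` of an `ℓ`-partite graph. An `ℓ`-partite structure on `G`
is given by the map `C` sending a vertex to the index of its class; that `C` is a proper
colouring says that each class is an independent set. -/
def vertexClass {V : Type*} [Fintype V] {G : SimpleGraph V} {ℓ : ℕ}
    (C : G.Coloring (Fin ℓ)) (i : Fin ℓ) : Finset V :=
  Finset.univ.filter (fun v => C v = i)

/-- An `ℓ`-partite graph on non-empty classes is balanced if its classes have the same size. -/
def IsBalanced {V : Type*} [Fintype V] {G : SimpleGraph V} {ℓ : ℕ}
    (C : G.Coloring (Fin ℓ)) : Prop :=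
  (∀ i, (vertexClass C i).Nonempty) ∧
    ∀ i j, (vertexClass C i).card = (vertexClass C j).card

/-- `K_r^+(t)` (for `r, t ≥ 2`): the complete `r`-partite graph with all classes of size `t`,
together with one edge (between the vertices numbered `0` and `1`) in the first class. -/
def completePlus (r t : ℕ) : SimpleGraph (Fin r × Fin t) where
  Adj a b := a.1 ≠ b.1 ∨
    (a.1.val = 0 ∧ b.1.val = 0 ∧
      ((a.2.val = 0 ∧ b.2.val = 1) ∨ (a.2.val = 1 ∧ b.2.val = 0)))
  symm := ⟨fun a b h => by
    rcases h with h | ⟨h₁, h₂, h₃⟩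
    · exact Or.inl h.symm
    · exact Or.inr ⟨h₂, h₁, by omega⟩⟩
  loopless := ⟨fun a h => by
    rcases h with h | ⟨-, -, h⟩
    · exact h rfl
    · omega⟩

/-- The admissible sizes `n_i^s` (`i` an index of a vertex class, `s` a colour). Indices start at
`0`, so the `(k-1)!` exceptional classes are those with `i < (k-1)!`; `π` enumerates all the
permutations of the colours. -/
def AdmissibleSizes (k ℓ : ℕ) (size : Fin ℓ → Fin (k - 1) → ℕ) : Prop :=
  (∃ π : Fin (k - 1).factorial ≃ Equiv.Perm (Fin (k - 1)),
    ∀ (i : Fin ℓ) (hi : i.val < (k - 1).factorial),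
      Antitone (fun s : Fin (k - 1) => size i (π ⟨i.val, hi⟩ s))) ∧
  (∀ i : Fin ℓ, (k - 1).factorial ≤ i.val →
    (∀ s t : Fin (k - 1), size i s = size i t) ∧ ∀ s : Fin (k - 1), 0 < size i s) ∧
  ∀ i : Fin ℓ, 0 < ∑ s : Fin (k - 1), size i s

/-- The vertices `(i, s, t)` with `1 ≤ t ≤ n_i^s`, written `⟨(i, s), t⟩`. -/
abbrev ExtremalVertex {k ℓ : ℕ} (size : Fin ℓ → Fin (k - 1) → ℕ) : Type :=
  Σ p : Fin ℓ × Fin (k - 1), Fin (size p.1 p.2)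

/-- The graph in which `(i, s, t)` and `(i', s', t')` are adjacent iff `i ≠ i'` and `s ≠ s'`. -/
def fullExtremalGraph {k ℓ : ℕ} (size : Fin ℓ → Fin (k - 1) → ℕ) :
    SimpleGraph (ExtremalVertex size) where
  Adj x y := x.1.1 ≠ y.1.1 ∧ x.1.2 ≠ y.1.2
  symm := ⟨fun _ _ h => ⟨h.1.symm, h.2.symm⟩⟩
  loopless := ⟨fun _ h => h.1 rfl⟩

/-- `H` arises from the full graph by removing some edges, all of them between two of the
first `(k-1)!` vertex classes. -/
def IsExtremalSubgraph {k ℓ : ℕ} (size : Fin ℓ → Fin (k - 1) → ℕ)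
    (H : SimpleGraph (ExtremalVertex size)) : Prop :=
  H ≤ fullExtremalGraph size ∧
    ∀ x y, (fullExtremalGraph size).Adj x y → ¬ H.Adj x y →
      x.1.1.val < (k - 1).factorial ∧ y.1.1.val < (k - 1).factorial

/-- `G` is isomorphic to a graph in the family `𝒢_ℓ^k` of extremal graphs
(for `k ≥ 3` and `ℓ ≥ (k-1)!`). -/
def IsoToExtremal {V : Type*} (k ℓ : ℕ) (G : SimpleGraph V) : Prop :=
  ∃ size : Fin ℓ → Fin (k - 1) → ℕ, AdmissibleSizes k ℓ size ∧
    ∃ H : SimpleGraph (ExtremalVertex size), IsExtremalSubgraph size H ∧ Nonempty (G ≃g H)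

/-!
Put `r = k - 1` and let `m` be the common size of the classes, so that `n = ℓ * m`. Suppose that
`G` contains no `K_r^+(t)` with `t` of order `log n`; it is shown that `G` is `r`-colourable and
that an `r`-colourable graph with the given densities is extremal.

The second claim (`isoToExtremal_of_proper`) is Chebyshev's sum inequality. If `n_i^s` is the
number of vertices of colour `s` in `V_i`, the density condition gives
`∑ s, n_i^s * n_j^s ≤ m ^ 2 / r` for `i ≠ j`. When `n_i` and `n_j` are sorted by the same
permutation the reverse inequality holds, with equality only if one of them is constant. Hence
non-constant classes have distinct sorting permutations, and there are at most `r!` of them.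
A constant class attains equality with every other class, so
that no pair of different colours is missing there.

For the first claim, a logarithmic Kővári–Sós–Turán argument (`exists_rungs`) shows that cliques
on `r + 1` vertices are rare. The edge density is within `1 / ℓ` of the Turán density, so the
Moon–Moser inequality is almost sharp; a typical `r`-clique then splits the vertices according to
the clique vertex they can replace, and few edges lie inside the parts
(`exists_coloring_card_innerPairs_le`). Let `p` be the `r`-colouring with the fewest adjacent
pairs of equal colour. No vertex has many neighbours in each colour (`exists_color_card_lt`), and
an edge between vertices of equal colour cannot have many common neighbours in each other colour
(`not_adj_of_card_common_ge`). So an end of such an edge is bad: it misses much of another colour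
class. Comparing with the density condition, summed over all pairs of classes, bounds the number
of bad vertices by `O(m)` (`card_innerPairs_le`), and hence all errors by a proportion `O(1 / ℓ)`.

Now a proportion `1 / r!` of the classes share a sorting permutation. On their union Chebyshev's
inequality makes the same comparison exact: there are no bad vertices, `p` is proper, and all but
at most one of these classes are split evenly and completely joined (`proper_of_antitone`,
`exists_const_classes`). Every vertex outside must miss at least a proportion `1 / r` of this
structure, and on average misses no more, so it is joined to everything there outside its own
colour. An edge between two vertices of equal colour would then produce `K_r^+(t)`, and `p` is
proper on all of `G` (`proper_of_const_classes`).
-/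

section
open Finset
open scoped Classical

variable {V : Type*}

/-! ### Complete partite graphs with classes of logarithmic size -/

/-- If a proportion `2 * (q + 1) * b` of the tuples in `∏ A i` belong to a family `M` of cliques,
then at least `b ^ q * L` members of `M`, no two of them sharing an entry at the same position,
together span a complete `(q + 1)`-partite graph; here `L` may be logarithmic in the sizes of the
`A i`. The induction on `q` spends a density `2 * b` at every step: the initial segments with many
extensions are handled by the induction hypothesis, and the last coordinate is added by a
pigeonhole over the subsets of the at most `L` segments obtained. -/
theorem exists_rungs (G : SimpleGraph V) {b : ℝ} (hb : 0 < b) {L : ℕ} (hL : 1 ≤ L) (q : ℕ) :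
    ∀ (A : Fin (q + 1) → Finset V), (∀ i, (L : ℝ) * 2 ^ L ≤ b * #(A i)) →
    ∀ M : Finset (Fin (q + 1) → V), M ⊆ Fintype.piFinset A →
    (∀ x ∈ M, ∀ i j, i ≠ j → G.Adj (x i) (x j)) →
    2 * (q + 1 : ℝ) * b * ∏ i, (#(A i) : ℝ) ≤ #M →
    ∃ S ⊆ M, b ^ q * L ≤ #S ∧ #S ≤ L ∧
      (∀ x ∈ S, ∀ y ∈ S, ∀ i j, i ≠ j → G.Adj (x i) (y j)) ∧
      ∀ x ∈ S, ∀ y ∈ S, ∀ i, x i = y i → x = y := by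
  have hLpos : (0 : ℝ) < (L : ℝ) * 2 ^ L := by
    have : (0 : ℝ) < L := by exact_mod_cast hL
    positivity
  have hL2 : (L : ℝ) ≤ (L : ℝ) * 2 ^ L :=
    le_mul_of_one_le_right (by positivity) (one_le_pow₀ (by norm_num))
  induction q with
  | zero =>
    intro A hA M hMA hM hcard
    have h0 := hA 0
    have hprod : ∏ i, (#(A i) : ℝ) = #(A 0) := Fin.prod_univ_one fun i => (#(A i) : ℝ)
    rw [hprod] at hcard
    norm_num at hcard
    have : L ≤ #M := by
      have : (L : ℝ) ≤ #M := by nlinarith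
      exact_mod_cast this
    obtain ⟨S, hSM, hS⟩ := exists_subset_card_eq this
    refine ⟨S, hSM, by simp [hS], hS.le, fun x _ y _ i j hij => ?_, fun x _ y _ i hxy => ?_⟩
    · exact absurd (Fin.subsingleton_one.elim i j) hij
    · funext j
      rwa [Fin.subsingleton_one.elim j i]
  | succ q ih =>
    intro A hA M hMA hM hcard
    set A' : Fin (q + 1) → Finset V := fun i => A i.castSucc with hA'
    set Z := A (Fin.last (q + 1)) with hZ
    have hZpos : (0 : ℝ) < #Z := by
      have := hA (Fin.last (q + 1))
      by_contra h
      have : (#Z : ℝ) ≤ 0 := not_lt.mp h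
      nlinarith
    let nb : (Fin (q + 1) → V) → Finset V :=
      fun x => Z.filter fun y => (Fin.snoc x y : Fin (q + 2) → V) ∈ M
    set M' := (Fintype.piFinset A').filter fun x => 2 * b * #Z ≤ #(nb x) with hM'
    -- counting the members of `M` by their first `q + 1` coordinates
    have hMsum : #M ≤ ∑ x ∈ Fintype.piFinset A', #(nb x) := by
      rw [← card_sigma]
      refine card_le_card_of_injOn (fun x => ⟨Fin.init x, x (Fin.last _)⟩) ?_ ?_
      · intro x hx
        have hxA := Fintype.mem_piFinset.1 (hMA hx)
        simp only [coe_sigma, Set.mem_sigma_iff, mem_coe, Fintype.mem_piFinset, nb, mem_filter,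
          Fin.snoc_init_self]
        exact ⟨fun i => hxA _, hxA _, hx⟩
      · intro x _ y _ hxy
        simp only [Sigma.mk.injEq, heq_eq_eq] at hxy
        rw [← Fin.snoc_init_self x, ← Fin.snoc_init_self y, hxy.1, hxy.2]
    have hprod : ∏ i, (#(A i) : ℝ) = (∏ i, (#(A' i) : ℝ)) * #Z := by
      rw [Fin.prod_univ_castSucc]
    have hM'card : 2 * (q + 1 : ℝ) * b * ∏ i, (#(A' i) : ℝ) ≤ #M' := by
      have h1 : (∑ x ∈ Fintype.piFinset A', (#(nb x) : ℝ))
          ≤ ∑ x ∈ Fintype.piFinset A', ((if 2 * b * #Z ≤ (#(nb x) : ℝ) then (#Z : ℝ) else 0)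
            + 2 * b * #Z) := by
        refine sum_le_sum fun x _ => ?_
        have h2 : (#(nb x) : ℝ) ≤ #Z := by exact_mod_cast card_filter_le _ _
        split_ifs with h
        · have : 0 ≤ 2 * b * #Z := by positivity
          linarith
        · linarith
      rw [sum_add_distrib, ← sum_filter, sum_const, sum_const, nsmul_eq_mul, nsmul_eq_mul,
        Fintype.card_piFinset] at h1
      have h2 : (#M : ℝ) ≤ ∑ x ∈ Fintype.piFinset A', (#(nb x) : ℝ) := by exact_mod_cast hMsum
      rw [hprod] at hcard
      push_cast at hcard h1
      have h3 : (2 * (q + 1 : ℝ) * b * ∏ i, (#(A' i) : ℝ)) * #Z ≤ #M' * #Z := by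
        rw [hM']
        nlinarith
      exact le_of_mul_le_mul_right h3 hZpos
    have hM'adj : ∀ x ∈ M', ∀ i j, i ≠ j → G.Adj (x i) (x j) := by
      intro x hx i j hij
      have hx2 := (mem_filter.1 hx).2
      have : 0 < #(nb x) := by
        have : (0 : ℝ) < #(nb x) := lt_of_lt_of_le (by positivity) hx2
        exact_mod_cast this
      obtain ⟨y, hy⟩ := card_pos.1 this
      have := hM _ (mem_filter.1 hy).2 i.castSucc j.castSucc
        (fun h => hij (Fin.castSucc_injective _ h))
      simpa using this
    obtain ⟨S', hS'M, hS'1, hS'2, hS'adj, hS'inj⟩ :=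
      ih A' (fun i => hA _) M' (filter_subset _ _) hM'adj hM'card
    have hS'pos : (0 : ℝ) < #S' := by
      refine lt_of_lt_of_le ?_ hS'1
      have : (0 : ℝ) < L := by exact_mod_cast hL
      positivity
    let R : V → Finset (Fin (q + 1) → V) :=
      fun y => S'.filter fun x => (Fin.snoc x y : Fin (q + 2) → V) ∈ M
    have hdouble : ∑ y ∈ Z, #(R y) = ∑ x ∈ S', #(nb x) := by
      simp only [R, nb, card_filter]
      exact sum_comm
    set Y := Z.filter fun y => b * #S' ≤ #(R y) with hY
    have hYcard : b * #Z ≤ #Y := by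
      have h1 : (∑ y ∈ Z, (#(R y) : ℝ)) ≤ ∑ y ∈ Z,
          ((if b * #S' ≤ (#(R y) : ℝ) then (#S' : ℝ) else 0) + b * #S') := by
        refine sum_le_sum fun y _ => ?_
        have h2 : (#(R y) : ℝ) ≤ #S' := by exact_mod_cast card_filter_le _ _
        split_ifs with h
        · have : 0 ≤ b * #S' := by positivity
          linarith
        · linarith
      rw [sum_add_distrib, ← sum_filter, sum_const, sum_const, nsmul_eq_mul, nsmul_eq_mul] at h1
      have h2 : (∑ x ∈ S', 2 * b * (#Z : ℝ)) ≤ ∑ x ∈ S', (#(nb x) : ℝ) :=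
        sum_le_sum fun x hx => (mem_filter.1 (hS'M hx)).2
      rw [sum_const, nsmul_eq_mul] at h2
      have h3 : (∑ y ∈ Z, (#(R y) : ℝ)) = ∑ x ∈ S', (#(nb x) : ℝ) := by exact_mod_cast hdouble
      have h4 : (b * #Z) * #S' ≤ #Y * #S' := by
        rw [hY]
        nlinarith
      exact le_of_mul_le_mul_right h4 hS'pos
    -- pigeonhole: many vertices of `Y` see exactly the same set of tuples
    have hpig : #S'.powerset * L ≤ #Y := by
      have h1 : (L : ℝ) * 2 ^ L ≤ #Y := (hA _).trans hYcard
      have h2 : L * 2 ^ L ≤ #Y := by exact_mod_cast h1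
      rw [card_powerset, mul_comm]
      exact (Nat.mul_le_mul_left _ (Nat.pow_le_pow_right (by norm_num) hS'2)).trans h2
    obtain ⟨S₁, hS₁, hfib⟩ := exists_le_card_fiber_of_mul_le_card_of_maps_to
      (f := R) (s := Y) (t := S'.powerset) (n := L)
      (fun y _ => mem_powerset.2 (filter_subset _ _)) ⟨∅, by simp⟩ hpig
    have hS₁S := mem_powerset.1 hS₁
    obtain ⟨y₀, hy₀⟩ := card_pos.1 (lt_of_lt_of_le hL hfib)
    have hS₁card : b * #S' ≤ #S₁ := by
      obtain ⟨h1, h2⟩ := mem_filter.1 hy₀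
      rw [← h2]
      exact (mem_filter.1 h1).2
    have hS₁L : #S₁ ≤ L := (card_le_card hS₁S).trans hS'2
    obtain ⟨Y₁, hY₁, hY₁card⟩ := exists_subset_card_eq (hS₁L.trans hfib)
    let φ : S₁ ≃ Y₁ := Finset.equivOfCardEq hY₁card.symm
    have hmem : ∀ x : S₁, (Fin.snoc x.1 (φ x).1 : Fin (q + 2) → V) ∈ M := by
      intro x
      have h1 := (mem_filter.1 (hY₁ (φ x).2)).2
      have h2 : x.1 ∈ R (φ x).1 := by rw [h1]; exact x.2
      exact (mem_filter.1 h2).2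
    have hmem' : ∀ x y : S₁, (Fin.snoc x.1 (φ y).1 : Fin (q + 2) → V) ∈ M := by
      intro x y
      have h1 := (mem_filter.1 (hY₁ (φ y).2)).2
      have h2 : x.1 ∈ R (φ y).1 := by rw [h1]; exact x.2
      exact (mem_filter.1 h2).2
    let e : S₁ → (Fin (q + 2) → V) := fun x => Fin.snoc x.1 (φ x).1
    have he : Function.Injective e := by
      intro x y hxy
      have := congrArg (fun f : Fin (q + 2) → V => (Fin.init f : Fin (q + 1) → V)) hxy
      simp only [e, Fin.init_snoc] at this
      exact Subtype.ext this
    refine ⟨univ.image e, ?_, ?_, ?_, ?_, ?_⟩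
    · intro z hz
      obtain ⟨x, -, rfl⟩ := mem_image.1 hz
      exact hmem x
    · rw [card_image_of_injective _ he, card_univ, Fintype.card_coe]
      calc b ^ (q + 1) * L = b * (b ^ q * L) := by ring
        _ ≤ b * #S' := by gcongr
        _ ≤ #S₁ := hS₁card
    · rw [card_image_of_injective _ he, card_univ, Fintype.card_coe]
      exact hS₁L
    · intro z hz w hw i j hij
      obtain ⟨x, -, rfl⟩ := mem_image.1 hz
      obtain ⟨y, -, rfl⟩ := mem_image.1 hw
      induction i using Fin.lastCases with
      | last =>
        induction j using Fin.lastCases with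
        | last => exact absurd rfl hij
        | cast j =>
          have := hM _ (hmem' y x) (Fin.last _) j.castSucc hij
          simpa [e] using this
      | cast i =>
        induction j using Fin.lastCases with
        | last =>
          have := hM _ (hmem' x y) i.castSucc (Fin.last _) hij
          simpa [e] using this
        | cast j =>
          have := hS'adj _ (hS₁S x.2) _ (hS₁S y.2) i j (fun h => hij (by rw [h]))
          simpa [e] using this
    · intro z hz w hw i hzw
      obtain ⟨x, -, rfl⟩ := mem_image.1 hz
      obtain ⟨y, -, rfl⟩ := mem_image.1 hw
      congr 1
      induction i using Fin.lastCases with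
      | last =>
        simp only [e, Fin.snoc_last] at hzw
        exact φ.injective (Subtype.ext hzw)
      | cast i =>
        simp only [e, Fin.snoc_castSucc] at hzw
        exact Subtype.ext (hS'inj _ (hS₁S x.2) _ (hS₁S y.2) i hzw)

/-- A logarithmic form of the Kővári–Sós–Turán theorem for `q`-partite cliques: if many tuples in
`∏ A i` are cliques, the sets `A i` contain the classes of a complete `q`-partite graph with
classes of size `t`. -/
theorem exists_completeParts (G : SimpleGraph V) {b : ℝ} (hb : 0 < b) {L t q : ℕ} (ht : 1 ≤ t)
    (hq : 1 ≤ q) (htL : (t : ℝ) ≤ b ^ (q - 1) * L)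
    (A : Fin q → Finset V) (hA : ∀ i, (L : ℝ) * 2 ^ L ≤ b * #(A i))
    (hcard : 2 * (q : ℝ) * b * ∏ i, (#(A i) : ℝ) ≤
      #((Fintype.piFinset A).filter fun x => ∀ i j, i ≠ j → G.Adj (x i) (x j))) :
    ∃ T : Fin q → Finset V, (∀ i, T i ⊆ A i) ∧ (∀ i, #(T i) = t) ∧
      ∀ i j, i ≠ j → ∀ x ∈ T i, ∀ y ∈ T j, G.Adj x y := by
  obtain ⟨q, rfl⟩ : ∃ q', q = q' + 1 := ⟨q - 1, by omega⟩
  have hL : 1 ≤ L := by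
    rcases Nat.eq_zero_or_pos L with h | h
    · subst h
      have : (1 : ℝ) ≤ t := by exact_mod_cast ht
      simp at htL
      omega
    · exact h
  push_cast at hcard
  obtain ⟨S, hSM, hS1, -, hSadj, hSinj⟩ := exists_rungs G hb hL q A hA _ (filter_subset _ _)
    (fun x hx => (mem_filter.1 hx).2) hcard
  have htS : t ≤ #S := by
    have : (t : ℝ) ≤ #S := htL.trans hS1
    exact_mod_cast this
  obtain ⟨S', hS'S, hS'⟩ := exists_subset_card_eq htS
  refine ⟨fun i => S'.image fun x => x i, fun i y hy => ?_, fun i => ?_, ?_⟩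
  · obtain ⟨x, hx, rfl⟩ := mem_image.1 hy
    exact Fintype.mem_piFinset.1 (mem_filter.1 (hSM (hS'S hx))).1 i
  · rw [card_image_of_injOn, hS']
    exact fun x hx y hy hxy => hSinj x (hS'S hx) y (hS'S hy) i hxy
  · intro i j hij x' hx' y' hy'
    obtain ⟨x, hx, rfl⟩ := mem_image.1 hx'
    obtain ⟨y, hy, rfl⟩ := mem_image.1 hy'
    exact hSadj x (hS'S hx) y (hS'S hy) i j hij

theorem exists_equiv_fin_of_mem {T : Finset V} {t : ℕ} (ht : 2 ≤ t) (hT : #T = t) {u v : V}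
    (hu : u ∈ T) (hv : v ∈ T) (huv : u ≠ v) :
    ∃ e : Fin t ≃ T, (e ⟨0, by omega⟩ : V) = u ∧ (e ⟨1, by omega⟩ : V) = v := by
  let e₀ : Fin t ≃ T := (Finset.equivFinOfCardEq hT).symm
  let e₁ : Fin t ≃ T := (Equiv.swap ⟨0, by omega⟩ (e₀.symm ⟨u, hu⟩)).trans e₀
  have h1 : e₁ ⟨0, by omega⟩ = ⟨u, hu⟩ := by simp [e₁]
  let e₂ : Fin t ≃ T := (Equiv.swap ⟨1, by omega⟩ (e₁.symm ⟨v, hv⟩)).trans e₁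
  refine ⟨e₂, ?_, by simp [e₂]⟩
  have h2 : Equiv.swap (⟨1, by omega⟩ : Fin t) (e₁.symm ⟨v, hv⟩) ⟨0, by omega⟩ = ⟨0, by omega⟩ := by
    refine Equiv.swap_apply_of_ne_of_ne (by simp) fun h => huv ?_
    have := congrArg e₁ h
    rw [h1, Equiv.apply_symm_apply] at this
    exact congrArg Subtype.val this
  simp [e₂, h2, h1]

theorem completePlus_isContained_of_edge_mem (G : SimpleGraph V) {r t : ℕ} (ht : 2 ≤ t)
    (T : Fin r → Finset V) (hT : ∀ i, #(T i) = t)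
    (hadj : ∀ i j, i ≠ j → ∀ x ∈ T i, ∀ y ∈ T j, G.Adj x y) (s₀ : Fin r) {u v : V}
    (huv : G.Adj u v) (hu : u ∈ T s₀) (hv : v ∈ T s₀) : (completePlus r t).IsContained G := by
  have hr : 0 < r := s₀.pos
  set z : Fin r := ⟨0, hr⟩ with hz
  let σ : Equiv.Perm (Fin r) := Equiv.swap z s₀
  have hσ : σ z = s₀ := Equiv.swap_apply_left _ _
  have key : ∀ i : Fin r, ∃ e : Fin t ≃ T (σ i),
      i = z → (e ⟨0, by omega⟩ : V) = u ∧ (e ⟨1, by omega⟩ : V) = v := by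
    intro i
    by_cases hi : i = z
    · have h : T (σ i) = T s₀ := by rw [hi, hσ]
      obtain ⟨e, he⟩ := exists_equiv_fin_of_mem ht (hT (σ i)) (h ▸ hu) (h ▸ hv) huv.ne
      exact ⟨e, fun _ => he⟩
    · exact ⟨(Finset.equivFinOfCardEq (hT (σ i))).symm, fun h => absurd h hi⟩
  choose e he using key
  let f : Fin r × Fin t → V := fun a => e a.1 a.2
  have hf : ∀ a b : Fin r × Fin t, a.1 ≠ b.1 → G.Adj (f a) (f b) := fun a b hab =>
    hadj _ _ (fun h => hab (σ.injective h)) _ (e a.1 a.2).2 _ (e b.1 b.2).2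
  refine ⟨⟨⟨f, ?_⟩, ?_⟩⟩
  · rintro ⟨a1, a2⟩ ⟨b1, b2⟩ (h | ⟨h1, h2, h3⟩)
    · exact hf _ _ h
    · have ha : a1 = z := Fin.ext h1
      have hb : b1 = z := Fin.ext h2
      subst ha hb
      obtain ⟨p0, p1⟩ := he z rfl
      rcases h3 with ⟨h3, h4⟩ | ⟨h3, h4⟩
      · have h3 : a2 = ⟨0, by omega⟩ := Fin.ext h3
        have h4 : b2 = ⟨1, by omega⟩ := Fin.ext h4
        have e1 : f (z, a2) = u := (congrArg (fun w => (e z w : V)) h3).trans p0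
        have e2 : f (z, b2) = v := (congrArg (fun w => (e z w : V)) h4).trans p1
        rwa [e1, e2]
      · have h3 : a2 = ⟨1, by omega⟩ := Fin.ext h3
        have h4 : b2 = ⟨0, by omega⟩ := Fin.ext h4
        have e1 : f (z, a2) = v := (congrArg (fun w => (e z w : V)) h3).trans p1
        have e2 : f (z, b2) = u := (congrArg (fun w => (e z w : V)) h4).trans p0
        rw [e1, e2]
        exact huv.symm
  · rintro ⟨a1, a2⟩ ⟨b1, b2⟩ h
    change f (a1, a2) = f (b1, b2) at h
    by_cases hab : a1 = b1
    · subst hab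
      simp only [f] at h
      rw [(e a1).injective (Subtype.ext h)]
    · exact absurd h (hf _ _ hab).ne

/-- Two vertices of the class `s₀` may be exchanged for the ends of an edge whose ends are both
joined to all the other classes. -/
theorem completePlus_isContained_of_edge_adj (G : SimpleGraph V) {r t : ℕ} (ht : 2 ≤ t)
    (T : Fin r → Finset V) (hT : ∀ i, #(T i) = t)
    (hadj : ∀ i j, i ≠ j → ∀ x ∈ T i, ∀ y ∈ T j, G.Adj x y) (s₀ : Fin r) {u v : V}
    (huv : G.Adj u v) (hu : ∀ i ≠ s₀, ∀ x ∈ T i, G.Adj u x)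
    (hv : ∀ i ≠ s₀, ∀ x ∈ T i, G.Adj v x) : (completePlus r t).IsContained G := by
  have h1 : t - 2 ≤ #(T s₀ \ {u, v}) := by
    have := le_card_sdiff {u, v} (T s₀)
    have h2 : #({u, v} : Finset V) ≤ 2 := card_le_two
    rw [hT] at this
    omega
  obtain ⟨R, hR, hRcard⟩ := exists_subset_card_eq h1
  have hRu : ∀ x ∈ R, x ≠ u ∧ x ≠ v := fun x hx => by
    have := (mem_sdiff.1 (hR hx)).2
    simpa using this
  have hmem : ∀ x ∈ {u, v} ∪ R, x = u ∨ x = v ∨ x ∈ T s₀ := by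
    intro x hx
    simp only [mem_union, mem_insert, mem_singleton] at hx
    rcases hx with (rfl | rfl) | hx
    · simp
    · simp
    · exact Or.inr (Or.inr (mem_sdiff.1 (hR hx)).1)
  have hside : ∀ j ≠ s₀, ∀ x ∈ {u, v} ∪ R, ∀ y ∈ T j, G.Adj x y := by
    intro j hj x hx y hy
    rcases hmem x hx with rfl | rfl | h
    · exact hu j hj y hy
    · exact hv j hj y hy
    · exact hadj _ _ hj.symm x h y hy
  refine completePlus_isContained_of_edge_mem G ht (Function.update T s₀ ({u, v} ∪ R)) ?_ ?_ s₀ huv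
    (by simp) (by simp)
  · intro i
    by_cases hi : i = s₀
    · subst hi
      rw [Function.update_self, card_union_of_disjoint, card_pair huv.ne, hRcard]
      · omega
      · rw [disjoint_right]
        intro x hx
        simpa using hRu x hx
    · rw [Function.update_of_ne hi, hT]
  · intro i j hij x hx y hy
    by_cases hi : i = s₀
    · subst hi
      rw [Function.update_self] at hx
      rw [Function.update_of_ne hij.symm] at hy
      exact hside j hij.symm x hx y hy
    · rw [Function.update_of_ne hi] at hx
      by_cases hj : j = s₀
      · subst hj
        rw [Function.update_self] at hy
        exact (hside i hi y hy x hx).symm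
      · rw [Function.update_of_ne hj] at hy
        exact hadj i j hij x hx y hy

theorem completePlus_isContained_of_vertex_adj (G : SimpleGraph V) {r t : ℕ} (hr : 0 < r)
    (ht : 2 ≤ t) (T : Fin r → Finset V) (hT : ∀ i, #(T i) = t)
    (hadj : ∀ i j, i ≠ j → ∀ x ∈ T i, ∀ y ∈ T j, G.Adj x y) {v : V}
    (hv : ∀ i, ∀ x ∈ T i, G.Adj v x) : (completePlus r t).IsContained G := by
  obtain ⟨w, hw⟩ : (T ⟨0, hr⟩).Nonempty := card_pos.1 (by rw [hT]; omega)
  exact completePlus_isContained_of_edge_adj G ht T hT hadj ⟨0, hr⟩ (hv _ w hw)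
    (fun i _ => hv i) (fun i hi x hx => hadj _ _ hi.symm w hw x hx)

/-! ### Nearly complete partite configurations -/

/-- The relations between the parameters under which a dense `r`- or `(r + 1)`-partite
configuration on classes of size at least `a₀` contains complete partite graphs with classes of
size `t`. The number `b` is the density lost in each step of the embedding and `L` is the
logarithmic length at which the embedding starts. -/
structure BlowupScale (r t L : ℕ) (b a₀ : ℝ) : Prop where
  two_le_r : 2 ≤ r
  two_le_t : 2 ≤ t
  b_pos : 0 < b
  b_le : 4 * (r + 1 : ℝ) * b ≤ 1
  t_le : (t : ℝ) ≤ b ^ r * L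
  L_le : (L : ℝ) * 2 ^ L ≤ b * a₀

theorem BlowupScale.b_le_one {r t L : ℕ} {b a₀ : ℝ} (hs : BlowupScale r t L b a₀) : b ≤ 1 := by
  have h1 := hs.b_le
  have h2 := hs.b_pos
  have h3 : (0 : ℝ) ≤ r := by positivity
  nlinarith [mul_nonneg h3 h2.le]

theorem BlowupScale.a₀_pos {r t L : ℕ} {b a₀ : ℝ} (hs : BlowupScale r t L b a₀) : 0 < a₀ := by
  have hL : (0 : ℝ) < L := by
    rcases Nat.eq_zero_or_pos L with h | h
    · have h1 := hs.t_le
      have h2 : (2 : ℝ) ≤ t := by exact_mod_cast hs.two_le_t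
      rw [h, Nat.cast_zero, mul_zero] at h1
      linarith
    · exact_mod_cast h
  have h1 : 0 < b * a₀ := lt_of_lt_of_le (by positivity) hs.L_le
  exact pos_of_mul_pos_right h1 hs.b_pos.le

/-- The ordered pairs of adjacent vertices of `U` with the same colour. -/
noncomputable def innerPairs (G : SimpleGraph V) {r : ℕ} (p : V → Fin r) (U : Finset V) :
    Finset (V × V) :=
  (U ×ˢ U).filter fun e => G.Adj e.1 e.2 ∧ p e.1 = p e.2

/-- The ordered pairs of non-adjacent vertices of `U` with different colours. -/
noncomputable def missingPairs (G : SimpleGraph V) {r : ℕ} (p : V → Fin r) (U : Finset V) :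
    Finset (V × V) :=
  (U ×ˢ U).filter fun e => ¬ G.Adj e.1 e.2 ∧ p e.1 ≠ p e.2

theorem card_missingPairs (G : SimpleGraph V) {r : ℕ} (p : V → Fin r) (U : Finset V) :
    #(missingPairs G p U) = 2 * #((missingPairs G p U).filter fun e => p e.1 < p e.2) := by
  have h1 : #((missingPairs G p U).filter fun e => ¬ p e.1 < p e.2) =
      #((missingPairs G p U).filter fun e => p e.1 < p e.2) := by
    refine card_bij' (fun e _ => e.swap) (fun e _ => e.swap) ?_ ?_ ?_ ?_
    · intro e he
      simp only [missingPairs, mem_filter, mem_product, not_lt] at he ⊢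
      exact ⟨⟨⟨he.1.1.2, he.1.1.1⟩, fun h => he.1.2.1 h.symm, he.1.2.2.symm⟩,
        lt_of_le_of_ne he.2 he.1.2.2.symm⟩
    · intro e he
      simp only [missingPairs, mem_filter, mem_product, not_lt] at he ⊢
      exact ⟨⟨⟨he.1.1.2, he.1.1.1⟩, fun h => he.1.2.1 h.symm, he.1.2.2.symm⟩, he.2.le⟩
    · intro e _
      simp
    · intro e _
      simp
  rw [← card_filter_add_card_filter_not (s := missingPairs G p U) fun e => p e.1 < p e.2, h1]
  ring

/-- In a random tuple of `∏ A i`, the entries `i` and `j` form a uniformly random pair. -/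
theorem card_filter_piFinset_mul_le {r : ℕ} (A : Fin r → Finset V) {i j : Fin r} (hij : i ≠ j)
    (Q : V → V → Prop) [DecidableRel Q] :
    #((Fintype.piFinset A).filter fun x => Q (x i) (x j)) * (#(A i) * #(A j)) ≤
      #((A i ×ˢ A j).filter fun e => Q e.1 e.2) * ∏ s, #(A s) := by
  rw [← Fintype.card_piFinset, ← card_product (A i), ← card_product, ← card_product]
  refine card_le_card_of_injOn
    (fun z => ((z.1 i, z.1 j), Function.update (Function.update z.1 i z.2.1) j z.2.2)) ?_ ?_
  · rintro ⟨x, u, v⟩ hz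
    simp only [coe_product, Set.mem_prod, mem_coe, mem_filter, Fintype.mem_piFinset,
      mem_product] at hz ⊢
    refine ⟨⟨⟨hz.1.1 i, hz.1.1 j⟩, hz.1.2⟩, fun s => ?_⟩
    by_cases h1 : s = j
    · subst h1
      simpa using hz.2.2
    · rw [Function.update_of_ne h1]
      by_cases h2 : s = i
      · subst h2
        simpa using hz.2.1
      · rw [Function.update_of_ne h2]
        exact hz.1.1 s
  · rintro ⟨x, u, v⟩ - ⟨x', u', v'⟩ - h
    simp only [Prod.mk.injEq] at h
    obtain ⟨⟨h1, h2⟩, h3⟩ := h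
    have hi := congrFun h3 i
    have hj := congrFun h3 j
    simp only [Function.update_self, Function.update_of_ne hij] at hi hj
    simp only [Prod.mk.injEq]
    refine ⟨funext fun s => ?_, hi, hj⟩
    by_cases hsj : s = j
    · rw [hsj, h2]
    · by_cases hsi : s = i
      · rw [hsi, h1]
      · have := congrFun h3 s
        simpa [Function.update_of_ne hsj, Function.update_of_ne hsi] using this

/-- Large subsets of the colour classes span a complete `r`-partite graph with classes of size `t`
when few pairs of different colours are missing: by a union bound, half of the transversal tuples
are cliques. -/
theorem exists_completeParts_of_card_missingPairs_le (G : SimpleGraph V) {r t L : ℕ} {b a₀ a : ℝ}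
    (hs : BlowupScale r t L b a₀) (ha : a₀ ≤ a) (p : V → Fin r) (U : Finset V)
    (hmiss : (#(missingPairs G p U) : ℝ) ≤ a ^ 2)
    (A : Fin r → Finset V) (hA : ∀ s, A s ⊆ U.filter fun x => p x = s)
    (hcard : ∀ s, a ≤ #(A s)) :
    ∃ T : Fin r → Finset V, (∀ i, T i ⊆ A i) ∧ (∀ i, #(T i) = t) ∧
      ∀ i j, i ≠ j → ∀ x ∈ T i, ∀ y ∈ T j, G.Adj x y := by
  have hr := hs.two_le_r
  have hb := hs.b_pos
  have hapos : 0 < a := hs.a₀_pos.trans_le ha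
  set P : ℝ := ∏ i, (#(A i) : ℝ) with hP
  have hPnn : 0 ≤ P := prod_nonneg fun i _ => by positivity
  set bad : Fin r × Fin r → Finset (Fin r → V) := fun ij =>
    (Fintype.piFinset A).filter fun x => ¬ G.Adj (x ij.1) (x ij.2) with hbad
  set I : Finset (Fin r × Fin r) := univ.filter fun ij => ij.1 < ij.2 with hI
  have hcover : (Fintype.piFinset A).filter (fun x => ¬ ∀ i j, i ≠ j → G.Adj (x i) (x j)) ⊆
      I.biUnion bad := by
    intro x hx
    obtain ⟨hxA, hx⟩ := mem_filter.1 hx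
    push Not at hx
    obtain ⟨i, j, hij, hx⟩ := hx
    simp only [mem_biUnion, hI, mem_filter, mem_univ, true_and, hbad, Prod.exists]
    rcases lt_or_gt_of_ne hij with h | h
    · exact ⟨i, j, h, hxA, hx⟩
    · exact ⟨j, i, h, hxA, fun h' => hx h'.symm⟩
  have hbadcard : ∀ ij ∈ I, (#(bad ij) : ℝ) * a ^ 2 ≤
      #((A ij.1 ×ˢ A ij.2).filter fun e => ¬ G.Adj e.1 e.2) * P := by
    intro ij hij
    have h1 := card_filter_piFinset_mul_le A (mem_filter.1 hij).2.ne fun u v => ¬ G.Adj u v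
    have h2 : (#(bad ij) : ℝ) * (#(A ij.1) * #(A ij.2)) ≤
        #((A ij.1 ×ˢ A ij.2).filter fun e => ¬ G.Adj e.1 e.2) * P := by
      simp only [hP, hbad]
      exact_mod_cast h1
    refine le_trans ?_ h2
    rw [pow_two]
    gcongr
    · exact hcard _
    · exact hcard _
  have hsum : ∑ ij ∈ I, #((A ij.1 ×ˢ A ij.2).filter fun e => ¬ G.Adj e.1 e.2) ≤
      #((missingPairs G p U).filter fun e => p e.1 < p e.2) := by
    rw [← card_biUnion]
    · refine card_le_card fun e he => ?_
      simp only [mem_biUnion, hI, mem_filter, mem_univ, true_and, mem_product, Prod.exists] at he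
      obtain ⟨i, j, hij, ⟨h1, h2⟩, h3⟩ := he
      have h1 := mem_filter.1 (hA i h1)
      have h2 := mem_filter.1 (hA j h2)
      simp only [missingPairs, mem_filter, mem_product]
      rw [h1.2, h2.2]
      exact ⟨⟨⟨h1.1, h2.1⟩, h3, hij.ne⟩, hij⟩
    · intro ij _ ij' _ hne
      rw [Function.onFun, disjoint_left]
      intro e he he'
      simp only [mem_filter, mem_product] at he he'
      refine hne (Prod.ext ?_ ?_)
      · rw [← (mem_filter.1 (hA _ he.1.1)).2, ← (mem_filter.1 (hA _ he'.1.1)).2]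
      · rw [← (mem_filter.1 (hA _ he.1.2)).2, ← (mem_filter.1 (hA _ he'.1.2)).2]
  have hcompl : (#((Fintype.piFinset A).filter
      (fun x => ¬ ∀ i j, i ≠ j → G.Adj (x i) (x j))) : ℝ) ≤ P / 2 := by
    have h1 : (#((Fintype.piFinset A).filter
        (fun x => ¬ ∀ i j, i ≠ j → G.Adj (x i) (x j))) : ℝ) ≤ ∑ ij ∈ I, (#(bad ij) : ℝ) := by
      exact_mod_cast (card_le_card hcover).trans card_biUnion_le
    have h2 : (∑ ij ∈ I, (#(bad ij) : ℝ)) * a ^ 2 ≤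
        (∑ ij ∈ I, (#((A ij.1 ×ˢ A ij.2).filter fun e => ¬ G.Adj e.1 e.2) : ℝ)) * P := by
      rw [sum_mul, sum_mul]
      exact sum_le_sum hbadcard
    have h3 : (∑ ij ∈ I, (#((A ij.1 ×ˢ A ij.2).filter fun e => ¬ G.Adj e.1 e.2) : ℝ)) ≤
        #((missingPairs G p U).filter fun e => p e.1 < p e.2) := by exact_mod_cast hsum
    have h4 : (#(missingPairs G p U) : ℝ) =
        2 * #((missingPairs G p U).filter fun e => p e.1 < p e.2) := by
      exact_mod_cast card_missingPairs G p U
    have h5 := mul_le_mul_of_nonneg_right h3 hPnn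
    have h6 := mul_le_mul_of_nonneg_right h1 (sq_nonneg a)
    have h7 := mul_le_mul_of_nonneg_right hmiss hPnn
    rw [h4] at h7
    refine le_of_mul_le_mul_right ?_ (pow_pos hapos 2)
    linarith
  have htotal : (#((Fintype.piFinset A).filter (fun x => ∀ i j, i ≠ j → G.Adj (x i) (x j))) : ℝ) +
      #((Fintype.piFinset A).filter (fun x => ¬ ∀ i j, i ≠ j → G.Adj (x i) (x j))) = P := by
    rw [hP]
    have := card_filter_add_card_filter_not (s := Fintype.piFinset A)
      fun x => ∀ i j, i ≠ j → G.Adj (x i) (x j)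
    rw [Fintype.card_piFinset] at this
    exact_mod_cast this
  have ht := hs.two_le_t
  refine exists_completeParts G hb (L := L) (by omega) (by omega) ?_ A ?_ ?_
  · exact hs.t_le.trans (mul_le_mul_of_nonneg_right
      (pow_le_pow_of_le_one hb.le hs.b_le_one (Nat.sub_le r 1)) (Nat.cast_nonneg L))
  · intro i
    exact hs.L_le.trans (mul_le_mul_of_nonneg_left (ha.trans (hcard i)) hb.le)
  · have h1 : 2 * (r : ℝ) * b * P ≤ 1 / 2 * P :=
      mul_le_mul_of_nonneg_right (by linarith [hs.b_le]) hPnn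
    linarith

/-- A vertex with many neighbours in each colour class would be joined to a complete `r`-partite
graph with classes of size `t`. -/
theorem exists_color_card_lt (G : SimpleGraph V) {r t L : ℕ} {b a₀ a : ℝ}
    (hs : BlowupScale r t L b a₀) (hfree : ¬ (completePlus r t).IsContained G)
    (ha : a₀ ≤ a) (p : V → Fin r) (U : Finset V)
    (hmiss : (#(missingPairs G p U) : ℝ) ≤ a ^ 2) (v : V) :
    ∃ s, (#(U.filter fun x => p x = s ∧ G.Adj v x) : ℝ) < a := by
  by_contra! h
  obtain ⟨T, hTA, hT, hadj⟩ := exists_completeParts_of_card_missingPairs_le G hs ha p U hmiss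
    (fun s => U.filter fun x => p x = s ∧ G.Adj v x)
    (fun s => monotone_filter_right _ fun x _ hx => hx.1) h
  exact hfree (completePlus_isContained_of_vertex_adj G (by have := hs.two_le_r; omega)
    hs.two_le_t T hT hadj fun i x hx => (mem_filter.1 (hTA i hx)).2.2)

/-- An edge whose ends have many common neighbours in each colour class but one would produce a
copy of `completePlus r t`. -/
theorem not_adj_of_card_common_ge (G : SimpleGraph V) {r t L : ℕ} {b a₀ a : ℝ}
    (hs : BlowupScale r t L b a₀) (hfree : ¬ (completePlus r t).IsContained G)
    (ha : a₀ ≤ a) (p : V → Fin r) (U : Finset V)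
    (hmiss : (#(missingPairs G p U) : ℝ) ≤ a ^ 2) (u v : V) (s₀ : Fin r)
    (hs₀ : a ≤ #(U.filter fun x => p x = s₀))
    (hcommon : ∀ s ≠ s₀, a ≤ #(U.filter fun x => p x = s ∧ G.Adj u x ∧ G.Adj v x)) :
    ¬ G.Adj u v := by
  intro huv
  obtain ⟨T, hTA, hT, hadj⟩ := exists_completeParts_of_card_missingPairs_le G hs ha p U hmiss
    (fun s => U.filter fun x => p x = s ∧ (s ≠ s₀ → G.Adj u x ∧ G.Adj v x))
    (fun s => monotone_filter_right _ fun x _ hx => hx.1) (fun s => by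
      by_cases h : s = s₀
      · simpa [h] using hs₀
      · simpa [h] using hcommon s h)
  exact hfree (completePlus_isContained_of_edge_adj G hs.two_le_t T hT hadj s₀ huv
    (fun i hi x hx => ((mem_filter.1 (hTA i hx)).2.2 hi).1)
    (fun i hi x hx => ((mem_filter.1 (hTA i hx)).2.2 hi).2))

/-! ### Stability from clique counts -/

variable [Fintype V]

/-- The cliques on `s` vertices, as ordered tuples. -/
noncomputable def cliqueTuples (G : SimpleGraph V) (s : ℕ) : Finset (Fin s → V) :=
  univ.filter fun x => ∀ i j, i ≠ j → G.Adj (x i) (x j)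

theorem mem_cliqueTuples {G : SimpleGraph V} {s : ℕ} {x : Fin s → V} :
    x ∈ cliqueTuples G s ↔ ∀ i j, i ≠ j → G.Adj (x i) (x j) := by
  simp [cliqueTuples]

theorem cons_mem_cliqueTuples {G : SimpleGraph V} {s : ℕ} {x : Fin s → V} {y : V} :
    (Fin.cons y x : Fin (s + 1) → V) ∈ cliqueTuples G (s + 1) ↔
      x ∈ cliqueTuples G s ∧ ∀ i, G.Adj y (x i) := by
  simp only [mem_cliqueTuples]
  constructor
  · intro h
    refine ⟨fun i j hij => ?_, fun i => ?_⟩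
    · simpa using h i.succ j.succ (fun h' => hij (Fin.succ_injective _ h'))
    · simpa using h 0 i.succ (Fin.succ_ne_zero i).symm
  · rintro ⟨h1, h2⟩ i j hij
    induction i using Fin.cases with
    | zero =>
      induction j using Fin.cases with
      | zero => exact absurd rfl hij
      | succ j => simpa using h2 j
    | succ i =>
      induction j using Fin.cases with
      | zero => simpa using (h2 i).symm
      | succ j => simpa using h1 i j (fun h => hij (by rw [h]))

theorem update_mem_cliqueTuples {G : SimpleGraph V} {s : ℕ} {x : Fin s → V}
    (hx : x ∈ cliqueTuples G s) {a : Fin s} {y : V} :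
    Function.update x a y ∈ cliqueTuples G s ↔ ∀ i ≠ a, G.Adj y (x i) := by
  rw [mem_cliqueTuples] at hx ⊢
  constructor
  · intro h i hi
    simpa [Function.update_of_ne hi] using h a i hi.symm
  · intro h i j hij
    by_cases hi : i = a
    · subst hi
      rw [Function.update_self, Function.update_of_ne hij.symm]
      exact h j hij.symm
    · rw [Function.update_of_ne hi]
      by_cases hj : j = a
      · subst hj
        rw [Function.update_self]
        exact (h i hi).symm
      · rw [Function.update_of_ne hj]
        exact hx i j hij

/-- Cauchy–Schwarz for the number of ways to exchange the vertex at position `a` of a clique. -/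
theorem card_cliqueTuples_sq_le (G : SimpleGraph V) (s : ℕ) (a : Fin (s + 1)) :
    #(cliqueTuples G (s + 1)) ^ 2 ≤ #(cliqueTuples G s) *
      ∑ x ∈ cliqueTuples G (s + 1),
        #(univ.filter fun y => Function.update x a y ∈ cliqueTuples G (s + 1)) := by
  let φ : (Fin (s + 1) → V) → (Fin s → V) := fun x => a.removeNth x
  have hφ : ∀ x ∈ cliqueTuples G (s + 1), φ x ∈ cliqueTuples G s := by
    intro x hx
    rw [mem_cliqueTuples] at hx ⊢
    exact fun i j hij => hx _ _ fun h => hij (Fin.succAbove_right_injective h)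
  let d : (Fin s → V) → ℕ := fun z => #((cliqueTuples G (s + 1)).filter fun x => φ x = z)
  have h1 : #(cliqueTuples G (s + 1)) = ∑ z ∈ cliqueTuples G s, d z :=
    card_eq_sum_card_fiberwise hφ
  have h2 : ∑ z ∈ cliqueTuples G s, d z ^ 2 = ∑ x ∈ cliqueTuples G (s + 1), d (φ x) := by
    rw [← sum_fiberwise_of_maps_to hφ]
    refine sum_congr rfl fun z _ => ?_
    rw [sum_congr rfl fun x hx => by rw [(mem_filter.1 hx).2], sum_const, smul_eq_mul, pow_two]
  rw [h1]
  refine sq_sum_le_card_mul_sum_sq.trans (Nat.mul_le_mul_left _ ?_)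
  rw [h2]
  refine sum_le_sum fun x _ => ?_
  have key : ∀ x', φ x' = φ x → Function.update x a (x' a) = x' := by
    intro x' h
    funext i
    induction i using Fin.succAboveCases a with
    | x => simp
    | p i =>
      rw [Function.update_of_ne (Fin.succAbove_ne a i)]
      exact (congrFun h i).symm
  refine card_le_card_of_injOn (fun x' => x' a) ?_ ?_
  · intro x' hx'
    obtain ⟨h3, h4⟩ := mem_filter.1 hx'
    simp only [coe_filter, mem_univ, true_and, Set.mem_ofPred_eq]
    rwa [key x' h4]
  · intro x' hx' x'' hx'' h
    rw [← key x' (mem_filter.1 hx').2, ← key x'' (mem_filter.1 hx'').2]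
    exact congrArg _ h

/-- A vertex that can replace two different vertices of a clique is adjacent to the whole clique.
-/
theorem sum_card_filter_update_le (G : SimpleGraph V) (s : ℕ) {x : Fin (s + 1) → V}
    (hx : x ∈ cliqueTuples G (s + 1)) :
    ∑ a, #(univ.filter fun y => Function.update x a y ∈ cliqueTuples G (s + 1)) ≤
      #(univ.filter fun y => ∃ a, Function.update x a y ∈ cliqueTuples G (s + 1)) +
      s * #(univ.filter fun y => (Fin.cons y x : Fin (s + 2) → V) ∈ cliqueTuples G (s + 2)) := by
  simp only [card_filter]
  rw [sum_comm, mul_sum, ← sum_add_distrib]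
  refine sum_le_sum fun y _ => ?_
  rw [← card_filter]
  by_cases h1 : ∃ a, Function.update x a y ∈ cliqueTuples G (s + 1)
  · rw [if_pos h1]
    by_cases h2 : (Fin.cons y x : Fin (s + 2) → V) ∈ cliqueTuples G (s + 2)
    · rw [if_pos h2]
      refine (card_le_univ _).trans ?_
      rw [Fintype.card_fin]
      omega
    · rw [if_neg h2, mul_zero, add_zero, card_le_one]
      intro a ha b hb
      by_contra hab
      refine h2 (cons_mem_cliqueTuples.2 ⟨hx, fun i => ?_⟩)
      have ha := (update_mem_cliqueTuples hx).1 (mem_filter.1 ha).2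
      have hb := (update_mem_cliqueTuples hx).1 (mem_filter.1 hb).2
      by_cases hi : i = a
      · exact hb i (hi ▸ hab)
      · exact ha i hi
  · push Not at h1
    rw [filter_false_of_mem (by simpa using h1)]
    simp

theorem sum_card_filter_cons_le (G : SimpleGraph V) (s : ℕ) :
    ∑ x ∈ cliqueTuples G s,
      #(univ.filter fun y => (Fin.cons y x : Fin (s + 1) → V) ∈ cliqueTuples G (s + 1)) ≤
    #(cliqueTuples G (s + 1)) := by
  rw [← card_sigma]
  refine card_le_card_of_injOn (fun z => (Fin.cons z.2 z.1 : Fin (s + 1) → V)) ?_ ?_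
  · rintro ⟨x, y⟩ hz
    simp only [coe_sigma, Set.mem_sigma_iff, mem_coe, mem_filter, mem_univ, true_and] at hz
    exact hz.2
  · rintro ⟨x, y⟩ - ⟨x', y'⟩ - h
    obtain ⟨rfl, rfl⟩ := Fin.cons_inj.1 h
    rfl

theorem mul_card_cliqueTuples_sq_le (G : SimpleGraph V) (s : ℕ) :
    (s + 1) * #(cliqueTuples G (s + 1)) ^ 2 ≤ #(cliqueTuples G s) *
      (∑ x ∈ cliqueTuples G (s + 1),
        #(univ.filter fun y => ∃ a, Function.update x a y ∈ cliqueTuples G (s + 1)) +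
        s * #(cliqueTuples G (s + 2))) := by
  calc (s + 1) * #(cliqueTuples G (s + 1)) ^ 2
      = ∑ a : Fin (s + 1), #(cliqueTuples G (s + 1)) ^ 2 := by simp
    _ ≤ ∑ a : Fin (s + 1), #(cliqueTuples G s) * ∑ x ∈ cliqueTuples G (s + 1),
        #(univ.filter fun y => Function.update x a y ∈ cliqueTuples G (s + 1)) :=
      sum_le_sum fun a _ => card_cliqueTuples_sq_le G s a
    _ = #(cliqueTuples G s) * ∑ x ∈ cliqueTuples G (s + 1), ∑ a,
        #(univ.filter fun y => Function.update x a y ∈ cliqueTuples G (s + 1)) := by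
      rw [← mul_sum, sum_comm]
    _ ≤ #(cliqueTuples G s) * ∑ x ∈ cliqueTuples G (s + 1),
        (#(univ.filter fun y => ∃ a, Function.update x a y ∈ cliqueTuples G (s + 1)) +
        s * #(univ.filter fun y =>
          (Fin.cons y x : Fin (s + 2) → V) ∈ cliqueTuples G (s + 2))) :=
      Nat.mul_le_mul_left _ (sum_le_sum fun x hx => sum_card_filter_update_le G s hx)
    _ ≤ _ := by
      rw [sum_add_distrib, ← mul_sum]
      exact Nat.mul_le_mul_left _ (Nat.add_le_add_left
        (Nat.mul_le_mul_left _ (sum_card_filter_cons_le G (s + 1))) _)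

/-- The Moon–Moser inequality, for ordered cliques. -/
theorem moon_moser (G : SimpleGraph V) (s : ℕ) :
    (s + 1) * #(cliqueTuples G (s + 1)) ^ 2 ≤ #(cliqueTuples G s) *
      (#(cliqueTuples G (s + 1)) * Fintype.card V + s * #(cliqueTuples G (s + 2))) := by
  refine (mul_card_cliqueTuples_sq_le G s).trans
    (Nat.mul_le_mul_left _ (Nat.add_le_add_right ?_ _))
  rw [← smul_eq_mul, ← sum_const]
  exact sum_le_sum fun x _ => card_le_univ _

/-- The colouring determined by a clique `x`: a vertex `y` gets a colour `a` such that `y` can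
replace `x a` in the clique. Vertices that can replace no vertex of the clique get the colour `0`.
-/
noncomputable def replacementColoring (G : SimpleGraph V) {s : ℕ} (x : Fin (s + 1) → V) (y : V) :
    Fin (s + 1) :=
  if h : ∃ a, Function.update x a y ∈ cliqueTuples G (s + 1) then h.choose else 0

theorem card_innerPairs_replacementColoring_le (G : SimpleGraph V) {s : ℕ} (x : Fin (s + 1) → V) :
    #(innerPairs G (replacementColoring G x) univ) ≤
      (∑ a, #(univ.filter fun e : V × V => G.Adj e.1 e.2 ∧
        Function.update x a e.1 ∈ cliqueTuples G (s + 1) ∧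
        Function.update x a e.2 ∈ cliqueTuples G (s + 1))) +
      2 * (Fintype.card V *
        #(univ.filter fun y => ¬ ∃ a, Function.update x a y ∈ cliqueTuples G (s + 1))) := by
  set U := univ.filter fun y => ¬ ∃ a, Function.update x a y ∈ cliqueTuples G (s + 1) with hU
  have hsub : innerPairs G (replacementColoring G x) univ ⊆
      (univ.biUnion fun a => univ.filter fun e : V × V => G.Adj e.1 e.2 ∧
        Function.update x a e.1 ∈ cliqueTuples G (s + 1) ∧
        Function.update x a e.2 ∈ cliqueTuples G (s + 1)) ∪ (univ ×ˢ U ∪ U ×ˢ univ) := by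
    rintro ⟨y, z⟩ he
    obtain ⟨hadj, heq⟩ := (mem_filter.1 he).2
    by_cases hy : ∃ a, Function.update x a y ∈ cliqueTuples G (s + 1)
    · by_cases hz : ∃ a, Function.update x a z ∈ cliqueTuples G (s + 1)
      · refine mem_union_left _ (mem_biUnion.2 ⟨hy.choose, mem_univ _, ?_⟩)
        simp only [replacementColoring, dif_pos hy, dif_pos hz] at heq
        refine mem_filter.2 ⟨mem_univ _, hadj, hy.choose_spec, ?_⟩
        rw [heq]
        exact hz.choose_spec
      · refine mem_union_right _ (mem_union_left _ ?_)
        simpa [hU] using hz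
    · refine mem_union_right _ (mem_union_right _ ?_)
      simpa [hU] using hy
  refine (card_le_card hsub).trans ((card_union_le _ _).trans ?_)
  refine add_le_add card_biUnion_le ((card_union_le _ _).trans ?_)
  rw [card_product, card_product, card_univ]
  exact le_of_eq (by ring)

/-- Two adjacent vertices that can both replace `x a` form a larger clique with the remaining
vertices of `x`. -/
theorem sum_card_inner_replacement_le (G : SimpleGraph V) (s : ℕ) (a : Fin (s + 1)) :
    ∑ x ∈ cliqueTuples G (s + 1), #(univ.filter fun e : V × V => G.Adj e.1 e.2 ∧
        Function.update x a e.1 ∈ cliqueTuples G (s + 1) ∧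
        Function.update x a e.2 ∈ cliqueTuples G (s + 1)) ≤
      Fintype.card V * #(cliqueTuples G (s + 2)) := by
  rw [← card_sigma, ← card_univ, ← card_product]
  refine card_le_card_of_injOn (fun z =>
    (z.1 a, (Fin.cons z.2.2 (Function.update z.1 a z.2.1) : Fin (s + 2) → V))) ?_ ?_
  · rintro ⟨x, y, z⟩ h
    simp only [coe_sigma, Set.mem_sigma_iff, mem_coe, mem_filter, mem_univ, true_and,
      coe_product, Set.mem_prod] at h ⊢
    obtain ⟨hx, hyz, hy, hz⟩ := h
    refine cons_mem_cliqueTuples.2 ⟨hy, fun i => ?_⟩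
    by_cases hi : i = a
    · subst hi
      rw [Function.update_self]
      exact hyz.symm
    · rw [Function.update_of_ne hi]
      exact (update_mem_cliqueTuples hx).1 hz i hi
  · rintro ⟨x, y, z⟩ - ⟨x', y', z'⟩ - h
    simp only [Prod.mk.injEq] at h
    obtain ⟨h1, h2⟩ := h
    obtain ⟨h3, h4⟩ := Fin.cons_inj.1 h2
    have h5 : y = y' := by simpa using congrFun h4 a
    have h6 : x = x' := by
      funext i
      by_cases hi : i = a
      · rw [hi, h1]
      · simpa [Function.update_of_ne hi] using congrFun h4 i
    rw [h3, h5, h6]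

/-- Averaged over all cliques `x`, the colouring by replacement has few adjacent pairs of equal
colour, provided that larger cliques are rare and the Moon–Moser inequality is almost sharp. -/
theorem exists_coloring_mul_card_innerPairs_le (G : SimpleGraph V) (s : ℕ)
    (hpos : 0 < #(cliqueTuples G (s + 1))) :
    ∃ f : V → Fin (s + 1), (#(innerPairs G f univ) : ℝ) * #(cliqueTuples G (s + 1)) *
        #(cliqueTuples G s) ≤
      (3 * s + 1) * Fintype.card V * #(cliqueTuples G s) * #(cliqueTuples G (s + 2)) +
      2 * Fintype.card V * (Fintype.card V * #(cliqueTuples G s) * #(cliqueTuples G (s + 1)) -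
        (s + 1) * (#(cliqueTuples G (s + 1)) : ℝ) ^ 2) := by
  set K := cliqueTuples G (s + 1) with hK
  set h₀ : ℝ := (#(cliqueTuples G s) : ℝ)
  set h₂ : ℝ := (#(cliqueTuples G (s + 2)) : ℝ)
  set n : ℝ := (Fintype.card V : ℝ)
  let cov : (Fin (s + 1) → V) → ℝ := fun x =>
    #(univ.filter fun y => ∃ a, Function.update x a y ∈ cliqueTuples G (s + 1))
  obtain ⟨x, hx, hmin⟩ := exists_min_image K
    (fun x => #(innerPairs G (replacementColoring G x) univ)) (card_pos.1 hpos)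
  refine ⟨replacementColoring G x, ?_⟩
  have h1 : (#(innerPairs G (replacementColoring G x) univ) : ℝ) * #K ≤
      ∑ x ∈ K, (#(innerPairs G (replacementColoring G x) univ) : ℝ) := by
    rw [mul_comm, ← nsmul_eq_mul]
    exact card_nsmul_le_sum _ _ _ fun y hy => by exact_mod_cast hmin y hy
  have h2 : ∀ x, (#(innerPairs G (replacementColoring G x) univ) : ℝ) ≤
      (∑ a, (#(univ.filter fun e : V × V => G.Adj e.1 e.2 ∧
        Function.update x a e.1 ∈ cliqueTuples G (s + 1) ∧
        Function.update x a e.2 ∈ cliqueTuples G (s + 1)) : ℝ)) + 2 * (n * (n - cov x)) := by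
    intro x
    have h3 := card_innerPairs_replacementColoring_le G x
    have h4 := card_filter_add_card_filter_not (s := (univ : Finset V))
      fun y => ∃ a, Function.update x a y ∈ cliqueTuples G (s + 1)
    rw [card_univ] at h4
    have h5 : n - cov x =
        #(univ.filter fun y => ¬ ∃ a, Function.update x a y ∈ cliqueTuples G (s + 1)) := by
      have h6 := congrArg (Nat.cast (R := ℝ)) h4
      push_cast at h6
      exact sub_eq_iff_eq_add'.2 h6.symm
    rw [h5]
    have h6 := (Nat.cast_le (α := ℝ)).2 h3
    push_cast at h6
    exact h6
  have h3 : (∑ x ∈ K, ∑ a, (#(univ.filter fun e : V × V => G.Adj e.1 e.2 ∧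
        Function.update x a e.1 ∈ cliqueTuples G (s + 1) ∧
        Function.update x a e.2 ∈ cliqueTuples G (s + 1)) : ℝ)) ≤ (s + 1) * (n * h₂) := by
    rw [sum_comm]
    have h4 : ∀ a : Fin (s + 1), (∑ x ∈ K, (#(univ.filter fun e : V × V => G.Adj e.1 e.2 ∧
        Function.update x a e.1 ∈ cliqueTuples G (s + 1) ∧
        Function.update x a e.2 ∈ cliqueTuples G (s + 1)) : ℝ)) ≤ n * h₂ := fun a => by
      have h6 := (Nat.cast_le (α := ℝ)).2 (sum_card_inner_replacement_le G s a)
      push_cast at h6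
      exact h6
    refine (sum_le_sum fun a _ => h4 a).trans (le_of_eq ?_)
    simp
  have h4 : (s + 1 : ℝ) * (#K : ℝ) ^ 2 ≤ h₀ * (∑ x ∈ K, cov x + s * h₂) := by
    have h6 := (Nat.cast_le (α := ℝ)).2 (mul_card_cliqueTuples_sq_le G s)
    push_cast at h6
    exact h6
  have h5 := sum_le_sum fun x (_ : x ∈ K) => h2 x
  rw [sum_add_distrib, ← mul_sum, ← mul_sum, sum_sub_distrib, sum_const, nsmul_eq_mul] at h5
  have hn : 0 ≤ n := by positivity
  have h0 : 0 ≤ h₀ := by positivity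
  have h6 := mul_le_mul_of_nonneg_right ((h1.trans h5).trans (add_le_add_left h3 _)) h0
  have h7 := mul_le_mul_of_nonneg_left h4 (mul_nonneg zero_le_two hn)
  linarith

/-- Starting from the edge density, the Moon–Moser inequality bounds the ratio of consecutive
clique numbers from below by nearly its value in the balanced complete `r`-partite graph. -/
theorem card_cliqueTuples_succ_ge (G : SimpleGraph V) {r : ℕ} {η : ℝ} (hη : 0 ≤ η)
    (hr : 2 ≤ r) (hrη : (r : ℝ) ^ 2 * η < 1) (hV : 0 < Fintype.card V)
    (h2 : (1 - 1 / r - η) * (Fintype.card V : ℝ) ^ 2 ≤ #(cliqueTuples G 2)) :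
    ∀ s < r, 0 < #(cliqueTuples G s) ∧ (1 - s / r - s * η) * (Fintype.card V : ℝ) *
      #(cliqueTuples G s) ≤ #(cliqueTuples G (s + 1)) := by
  have hn : (0 : ℝ) < Fintype.card V := by exact_mod_cast hV
  set n : ℝ := (Fintype.card V : ℝ)
  have hr0 : (0 : ℝ) < r := by positivity
  have c0 : #(cliqueTuples G 0) = 1 := by
    rw [card_eq_one]
    refine ⟨Fin.elim0, eq_singleton_iff_unique_mem.2 ⟨mem_cliqueTuples.2 fun i => i.elim0,
      fun x _ => Subsingleton.elim _ _⟩⟩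
  have c1 : #(cliqueTuples G 1) = Fintype.card V := by
    rw [cliqueTuples, filter_true_of_mem
      (fun x _ i j hij => absurd (Subsingleton.elim i j) hij), card_univ]
    simp
  intro s
  induction s with
  | zero =>
    intro _
    rw [zero_add, c0, c1]
    simp [n]
  | succ s ih =>
    intro hs
    obtain ⟨hpos, hle⟩ := ih (by omega)
    have hsr : (s : ℝ) + 1 ≤ r - 1 := by
      have : (s + 1 : ℕ) + 1 ≤ r := hs
      have : ((s + 1 : ℕ) : ℝ) + 1 ≤ r := by exact_mod_cast this
      push_cast at this
      linarith
    have hs0 : (0 : ℝ) ≤ s := by positivity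
    have hfac : 0 < 1 - (s : ℝ) / r - s * η := by
      have h3 : (s : ℝ) * η ≤ r * η := mul_le_mul_of_nonneg_right (by linarith) hη
      have h4 : (1 - (s : ℝ) / r - s * η) * r = r - s - s * η * r := by
        field_simp
      have h5 : s * η * r ≤ (r : ℝ) ^ 2 * η := by nlinarith
      have : 0 < (1 - (s : ℝ) / r - s * η) * r := by rw [h4]; linarith
      exact pos_of_mul_pos_left this hr0.le
    have hposR : (0 : ℝ) < #(cliqueTuples G s) := by exact_mod_cast hpos
    have hpos1 : (0 : ℝ) < #(cliqueTuples G (s + 1)) :=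
      lt_of_lt_of_le (by positivity) hle
    refine ⟨by exact_mod_cast hpos1, ?_⟩
    rcases Nat.eq_zero_or_pos s with rfl | hspos
    · rw [zero_add, c1]
      push_cast
      simp only [one_mul]
      calc (1 - 1 / (r : ℝ) - η) * n * n = (1 - 1 / r - η) * n ^ 2 := by ring
        _ ≤ _ := h2
    · have hm : ((s : ℝ) + 1) * (#(cliqueTuples G (s + 1)) : ℝ) ^ 2 ≤ #(cliqueTuples G s) *
          (#(cliqueTuples G (s + 1)) * n + s * #(cliqueTuples G (s + 2))) := by
        have h6 := (Nat.cast_le (α := ℝ)).2 (moon_moser G s)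
        push_cast at h6
        exact h6
      have hsp : (0 : ℝ) < s := by exact_mod_cast hspos
      set x : ℝ := (#(cliqueTuples G s) : ℝ)
      set y : ℝ := (#(cliqueTuples G (s + 1)) : ℝ)
      set z : ℝ := (#(cliqueTuples G (s + 1 + 1)) : ℝ)
      have h3 : ((s : ℝ) + 1) * ((1 - s / r - s * η) * n) * y ≤ y * n + s * z := by
        have : (((s : ℝ) + 1) * ((1 - s / r - s * η) * n) * y) * x ≤ (y * n + s * z) * x := by
          nlinarith [mul_le_mul_of_nonneg_left hle (mul_nonneg (by positivity : (0:ℝ) ≤ s + 1)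
            hpos1.le)]
        exact le_of_mul_le_mul_right this hposR
      have h4 : (s : ℝ) * ((1 - (s + 1) / r - (s + 1) * η) * n * y) ≤ s * z := by
        have : ((s : ℝ) + 1) * ((1 - s / r - s * η) * n) * y - y * n =
          (s : ℝ) * ((1 - (s + 1) / r - (s + 1) * η) * n * y) := by ring
        linarith
      push_cast
      exact le_of_mul_le_mul_left h4 hsp

theorem card_cliqueTuples_ge (G : SimpleGraph V) {r : ℕ} {η : ℝ} (hη : 0 ≤ η)
    (hr : 2 ≤ r) (hrη : (r : ℝ) ^ 2 * η < 1) (hV : 0 < Fintype.card V)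
    (h2 : (1 - 1 / r - η) * (Fintype.card V : ℝ) ^ 2 ≤ #(cliqueTuples G 2)) :
    ∀ s ≤ r, (1 - (r : ℝ) ^ 2 * η) ^ s * (Fintype.card V : ℝ) ^ s * r.descFactorial s ≤
      #(cliqueTuples G s) * (r : ℝ) ^ s := by
  have hr0 : (0 : ℝ) < r := by positivity
  intro s
  induction s with
  | zero =>
    intro _
    have := (card_cliqueTuples_succ_ge G hη hr hrη hV h2 0 (by omega)).1
    simp only [pow_zero, Nat.descFactorial_zero, Nat.cast_one, mul_one]
    exact_mod_cast this
  | succ s ih =>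
    intro hs
    have h3 := (card_cliqueTuples_succ_ge G hη hr hrη hV h2 s (by omega)).2
    have h4 := ih (by omega)
    set n : ℝ := (Fintype.card V : ℝ)
    set q : ℝ := 1 - (r : ℝ) ^ 2 * η with hq
    have hq0 : 0 < q := by linarith
    have hsr : (s : ℝ) + 1 ≤ r := by exact_mod_cast hs
    have hs0 : (0 : ℝ) ≤ s := by positivity
    have h5 : ((r : ℝ) - s) * q ≤ (1 - s / r - s * η) * r := by
      have : (1 - (s : ℝ) / r - s * η) * r = r - s - s * η * r := by field_simp
      rw [this, hq]
      have h6 : (s : ℝ) ≤ (r - s) * r := by nlinarith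
      nlinarith [mul_le_mul_of_nonneg_right h6 (mul_nonneg hη hr0.le)]
    rw [Nat.descFactorial_succ, Nat.cast_mul, Nat.cast_sub (by omega)]
    have hn : 0 ≤ n := by positivity
    calc q ^ (s + 1) * n ^ (s + 1) * (((r : ℝ) - s) * r.descFactorial s)
        = (((r : ℝ) - s) * q) * n * (q ^ s * n ^ s * r.descFactorial s) := by ring
      _ ≤ (((r : ℝ) - s) * q) * n * (#(cliqueTuples G s) * (r : ℝ) ^ s) := by
        refine mul_le_mul_of_nonneg_left h4 (mul_nonneg (mul_nonneg (by linarith) hq0.le) hn)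
      _ ≤ ((1 - s / r - s * η) * r) * n * (#(cliqueTuples G s) * (r : ℝ) ^ s) := by
        gcongr
      _ = ((1 - s / r - s * η) * n * #(cliqueTuples G s)) * (r : ℝ) ^ (s + 1) := by ring
      _ ≤ _ := by gcongr

/-- Stability: a graph whose edge density is nearly `1 - 1 / r`, and which has few cliques on
`r + 1` vertices, has an `r`-colouring with few adjacent pairs of equal colour. -/
theorem exists_coloring_card_innerPairs_le (G : SimpleGraph V) {r : ℕ} {η γ : ℝ} (hη : 0 ≤ η)
    (hr : 2 ≤ r) (hrη : (r : ℝ) ^ 3 * η ≤ 1 / 10) (hV : 0 < Fintype.card V)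
    (h2 : (1 - 1 / r - η) * (Fintype.card V : ℝ) ^ 2 ≤ #(cliqueTuples G 2))
    (hγ : (#(cliqueTuples G (r + 1)) : ℝ) ≤ γ * (Fintype.card V : ℝ) ^ (r + 1)) :
    ∃ f : V → Fin r, (#(innerPairs G f univ) : ℝ) ≤
      (3 * r * γ * (10 / 9) * (r ^ r / r.factorial) + 2 * r ^ 2 * η) *
        (Fintype.card V : ℝ) ^ 2 := by
  have hr0 : (2 : ℝ) ≤ r := by exact_mod_cast hr
  have hr2η : (r : ℝ) ^ 2 * η < 1 := by
    have : (r : ℝ) ^ 2 * η ≤ r ^ 3 * η := by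
      gcongr
      · linarith
      · norm_num
    linarith
  have hn : (0 : ℝ) < Fintype.card V := by exact_mod_cast hV
  have hB := card_cliqueTuples_ge G hη hr hr2η hV h2 r le_rfl
  obtain ⟨s, rfl⟩ : ∃ s, r = s + 1 := ⟨r - 1, by omega⟩
  have hA := card_cliqueTuples_succ_ge G hη hr hr2η hV h2 s (Nat.lt_succ_self s)
  rw [Nat.descFactorial_self] at hB
  set n : ℝ := (Fintype.card V : ℝ)
  set R : ℝ := ((s + 1 : ℕ) : ℝ) with hR
  have hsR : (s : ℝ) = R - 1 := by rw [hR]; push_cast; ring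
  have hbern : 9 / 10 ≤ (1 - R ^ 2 * η) ^ (s + 1) := by
    have h3 := one_add_mul_le_pow (a := -(R ^ 2 * η)) (by linarith) (s + 1)
    rw [← hR] at h3
    have h4 : 1 + R * -(R ^ 2 * η) = 1 - R ^ 3 * η := by ring
    rw [h4] at h3
    rw [sub_eq_add_neg]
    linarith
  have hfac : (0 : ℝ) < (s + 1).factorial := by exact_mod_cast Nat.factorial_pos _
  set h₀ : ℝ := (#(cliqueTuples G s) : ℝ)
  set h₁ : ℝ := (#(cliqueTuples G (s + 1)) : ℝ)
  set h₂ : ℝ := (#(cliqueTuples G (s + 1 + 1)) : ℝ)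
  have h0pos : 0 < h₀ := Nat.cast_pos.2 hA.1
  have hR0 : 0 < R := by linarith
  have hB' : 9 / 10 * n ^ (s + 1) * (s + 1).factorial ≤ h₁ * R ^ (s + 1) := by
    refine le_trans ?_ hB
    gcongr
  have h1pos : 0 < h₁ := by
    have : 0 < h₁ * R ^ (s + 1) := lt_of_lt_of_le (by positivity) hB'
    exact pos_of_mul_pos_left this (by positivity)
  obtain ⟨f, hf⟩ := exists_coloring_mul_card_innerPairs_le G s (Nat.cast_pos.1 h1pos)
  refine ⟨f, ?_⟩
  rw [hsR] at hf
  set I : ℝ := (#(innerPairs G f univ) : ℝ)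
  have e1 : n * h₀ ≤ R * h₁ + R ^ 2 * η * (n * h₀) := by
    have h3 := hA.2
    rw [hsR] at h3
    have h4 : (1 - (R - 1) / R - (R - 1) * η) * R = 1 - (R - 1) * R * η := by
      field_simp
      ring
    have h5 := mul_le_mul_of_nonneg_right h3 hR0.le
    have h6 : (1 - (R - 1) / R - (R - 1) * η) * n * h₀ * R = (1 - (R - 1) * R * η) * (n * h₀) := by
      rw [← h4]; ring
    rw [h6] at h5
    have h7 : 0 ≤ R * η * (n * h₀) := by positivity
    nlinarith
  -- the number of cliques on `r + 1` vertices, relative to the number on `r` vertices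
  have e2 : h₂ ≤ γ * (10 / 9) * (R ^ (s + 1) / (s + 1).factorial) * n * h₁ := by
    have hγ0 : 0 ≤ γ := by
      have : 0 ≤ γ * n ^ (s + 1 + 1) := le_trans (by positivity) hγ
      exact nonneg_of_mul_nonneg_left this (by positivity)
    calc h₂ ≤ γ * n ^ (s + 1 + 1) := hγ
      _ = γ * (10 / 9) / (s + 1).factorial * n * (9 / 10 * n ^ (s + 1) * (s + 1).factorial) := by
        field_simp
        ring
      _ ≤ γ * (10 / 9) / (s + 1).factorial * n * (h₁ * R ^ (s + 1)) := by gcongr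
      _ = _ := by ring
  set c := γ * (10 / 9) * (R ^ (s + 1) / (s + 1).factorial) with hc
  have e3 : I * (h₁ * h₀) ≤ ((3 * R * c + 2 * R ^ 2 * η) * n ^ 2) * (h₁ * h₀) := by
    have e4 : (3 * (R - 1) + 1) * n * h₀ * h₂ ≤ 3 * R * n * h₀ * (c * n * h₁) := by
      have : (3 * (R - 1) + 1) ≤ 3 * R := by linarith
      have : 0 ≤ h₂ := by positivity
      gcongr
    have e5 : 2 * n * (n * h₀ * h₁ - (R - 1 + 1) * h₁ ^ 2) ≤
        2 * n * (h₁ * (R ^ 2 * η * (n * h₀))) := by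
      have : n * h₀ * h₁ - (R - 1 + 1) * h₁ ^ 2 ≤ h₁ * (R ^ 2 * η * (n * h₀)) := by
        nlinarith
      gcongr
    calc I * (h₁ * h₀) = I * h₁ * h₀ := by ring
      _ ≤ _ := hf
      _ ≤ 3 * R * n * h₀ * (c * n * h₁) + 2 * n * (h₁ * (R ^ 2 * η * (n * h₀))) := add_le_add e4 e5
      _ = _ := by ring
  have e6 := le_of_mul_le_mul_right e3 (mul_pos h1pos h0pos)
  refine e6.trans (le_of_eq ?_)
  rw [hc]
  ring

/-! ### Bad vertices of a balanced multipartite graph -/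

theorem card_innerPairs_eq (G : SimpleGraph V) {r : ℕ} (p : V → Fin r) (v : V) :
    #(innerPairs G p univ) =
      #(univ.filter fun e : V × V => (e.1 ≠ v ∧ e.2 ≠ v) ∧ G.Adj e.1 e.2 ∧ p e.1 = p e.2) +
        2 * #(univ.filter fun x => p x = p v ∧ G.Adj v x) := by
  have h1 : innerPairs G p univ =
      (univ.filter fun e : V × V => (e.1 ≠ v ∧ e.2 ≠ v) ∧ G.Adj e.1 e.2 ∧ p e.1 = p e.2) ∪
      ((univ.filter fun x => p x = p v ∧ G.Adj v x).image (fun x => (v, x)) ∪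
        (univ.filter fun x => p x = p v ∧ G.Adj v x).image fun x => (x, v)) := by
    ext ⟨x, y⟩
    simp only [innerPairs, mem_filter, mem_product, mem_univ, true_and, mem_union, mem_image,
      Prod.mk.injEq]
    constructor
    · rintro ⟨h, h'⟩
      by_cases hx : x = v
      · subst hx
        exact Or.inr (Or.inl ⟨y, ⟨h'.symm, h⟩, rfl, rfl⟩)
      · by_cases hy : y = v
        · subst hy
          exact Or.inr (Or.inr ⟨x, ⟨h', h.symm⟩, rfl, rfl⟩)
        · exact Or.inl ⟨⟨hx, hy⟩, h, h'⟩
    · rintro (⟨-, h⟩ | ⟨z, ⟨h1, h2⟩, rfl, rfl⟩ | ⟨z, ⟨h1, h2⟩, rfl, rfl⟩)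
      · exact h
      · exact ⟨h2, h1.symm⟩
      · exact ⟨h2.symm, h1⟩
  rw [h1, card_union_of_disjoint, card_union_of_disjoint, card_image_of_injective,
    card_image_of_injective]
  · ring
  · exact fun x y h => (Prod.mk.inj h).1
  · exact fun x y h => (Prod.mk.inj h).2
  · rw [disjoint_left]
    rintro ⟨x, y⟩ h2 h3
    simp only [mem_image, mem_filter, mem_univ, true_and, Prod.mk.injEq] at h2 h3
    obtain ⟨z, ⟨-, hz⟩, rfl, rfl⟩ := h2
    obtain ⟨w, ⟨-, hw⟩, rfl, rfl⟩ := h3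
    exact hz.ne rfl
  · rw [disjoint_left]
    rintro ⟨x, y⟩ h2 h3
    simp only [mem_union, mem_image, mem_filter, mem_univ, true_and, Prod.mk.injEq] at h2 h3
    rcases h3 with ⟨z, -, rfl, rfl⟩ | ⟨z, -, rfl, rfl⟩
    · exact h2.1.1 rfl
    · exact h2.1.2 rfl

/-- In a colouring with the fewest adjacent pairs of equal colour, no vertex has more neighbours
of its own colour than of any other colour. -/
theorem exists_minimal_coloring (G : SimpleGraph V) {r : ℕ} (hr : 0 < r) :
    ∃ p : V → Fin r, (∀ f : V → Fin r, #(innerPairs G p univ) ≤ #(innerPairs G f univ)) ∧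
      ∀ v s, #(univ.filter fun x => p x = p v ∧ G.Adj v x) ≤
        #(univ.filter fun x => p x = s ∧ G.Adj v x) := by
  have : Nonempty (V → Fin r) := ⟨fun _ => ⟨0, hr⟩⟩
  obtain ⟨p, hp⟩ := Finite.exists_min fun p : V → Fin r => #(innerPairs G p univ)
  refine ⟨p, hp, fun v s => ?_⟩
  have h := hp (Function.update p v s)
  rw [card_innerPairs_eq G p v, card_innerPairs_eq G _ v] at h
  have h1 : (univ.filter fun e : V × V => (e.1 ≠ v ∧ e.2 ≠ v) ∧ G.Adj e.1 e.2 ∧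
      Function.update p v s e.1 = Function.update p v s e.2) =
      univ.filter fun e : V × V => (e.1 ≠ v ∧ e.2 ≠ v) ∧ G.Adj e.1 e.2 ∧ p e.1 = p e.2 := by
    refine filter_congr fun e _ => and_congr_right fun he => ?_
    rw [Function.update_of_ne he.1, Function.update_of_ne he.2]
  have h2 : (univ.filter fun x => Function.update p v s x = Function.update p v s v ∧ G.Adj v x) =
      univ.filter fun x => p x = s ∧ G.Adj v x := by
    refine filter_congr fun x _ => and_congr_left fun hx => ?_
    rw [Function.update_self, Function.update_of_ne hx.ne']
  rw [h1, h2] at h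
  omega

/-- The map `c` splits the vertices of `G` into independent classes of size `m`, any two of which
have at most `m ^ 2 / r` pairs of non-adjacent vertices between them. -/
structure BalancedDense (G : SimpleGraph V) {ℓ : ℕ} (c : V → Fin ℓ) (r m : ℕ) : Prop where
  ne_of_adj : ∀ u v, G.Adj u v → c u ≠ c v
  card_class : ∀ i, #(univ.filter fun v => c v = i) = m
  card_nonadj_le : ∀ i j, i ≠ j →
    r * #(univ.filter fun e : V × V => (c e.1 = i ∧ c e.2 = j) ∧ ¬ G.Adj e.1 e.2) ≤ m ^ 2

/-- The union of the classes with index in `J`. -/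
noncomputable def classUnion {ℓ : ℕ} (c : V → Fin ℓ) (J : Finset (Fin ℓ)) : Finset V :=
  univ.filter fun v => c v ∈ J

/-- The ordered pairs of vertices in two different classes with index in `J`. -/
noncomputable def distinctClassPairs {ℓ : ℕ} (c : V → Fin ℓ) (J : Finset (Fin ℓ)) :
    Finset (V × V) :=
  (classUnion c J ×ˢ classUnion c J).filter fun e => c e.1 ≠ c e.2

namespace BalancedDense

variable {G : SimpleGraph V} {ℓ : ℕ} {c : V → Fin ℓ} {r m : ℕ}

theorem card_classUnion (h : BalancedDense G c r m) (J : Finset (Fin ℓ)) :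
    #(classUnion c J) = #J * m := by
  have hmaps : Set.MapsTo c (classUnion c J) J := fun x hx => (mem_filter.1 hx).2
  rw [card_eq_sum_card_fiberwise hmaps]
  rw [← smul_eq_mul, ← sum_const]
  refine sum_congr rfl fun i hi => ?_
  rw [← h.card_class i]
  congr 1
  ext v
  simp only [classUnion, mem_filter, mem_univ, true_and]
  exact ⟨fun h => h.2, fun h => ⟨h ▸ hi, h⟩⟩

theorem card_nonadj_distinctClassPairs_le (h : BalancedDense G c r m) (J : Finset (Fin ℓ)) :
    (r : ℝ) * #((distinctClassPairs c J).filter fun e => ¬ G.Adj e.1 e.2) ≤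
      #J * (#J - 1) * (m : ℝ) ^ 2 := by
  have h1 : r * #((distinctClassPairs c J).filter fun e => ¬ G.Adj e.1 e.2) ≤
      ∑ ij ∈ J.offDiag, m ^ 2 := by
    rw [card_eq_sum_card_fiberwise (f := fun e => (c e.1, c e.2)) (t := J.offDiag), mul_sum]
    · refine sum_le_sum fun ij hij => le_trans (Nat.mul_le_mul_left _ (card_le_card ?_))
        (h.card_nonadj_le ij.1 ij.2 (mem_offDiag.1 hij).2.2)
      intro e he
      simp only [mem_filter, mem_univ, true_and] at he ⊢
      exact ⟨⟨by rw [← he.2], by rw [← he.2]⟩, he.1.2⟩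
    · intro e he
      simp only [distinctClassPairs, classUnion, coe_filter, mem_filter, mem_product, mem_univ,
        true_and, Set.mem_ofPred_eq] at he
      simpa using ⟨he.1.1.1, he.1.1.2, he.1.2⟩
  rw [sum_const, smul_eq_mul, offDiag_card] at h1
  have h2 := (Nat.cast_le (α := ℝ)).2 h1
  rw [Nat.cast_mul, Nat.cast_mul, Nat.cast_sub (Nat.le_mul_self _)] at h2
  push_cast at h2
  linarith

/-- Both sides count the pairs that have equal colours or are non-adjacent, since adjacent
vertices lie in different classes. -/
theorem card_same_add_card_cross (h : BalancedDense G c r m) (J : Finset (Fin ℓ))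
    (p : V → Fin r) :
    #((distinctClassPairs c J).filter fun e => p e.1 = p e.2) +
      #((distinctClassPairs c J).filter fun e => ¬ G.Adj e.1 e.2 ∧ p e.1 ≠ p e.2) =
    #((distinctClassPairs c J).filter fun e => ¬ G.Adj e.1 e.2) +
      #(innerPairs G p (classUnion c J)) := by
  have h1 : innerPairs G p (classUnion c J) =
      ((distinctClassPairs c J).filter fun e => p e.1 = p e.2).filter fun e => G.Adj e.1 e.2 := by
    ext e
    simp only [innerPairs, distinctClassPairs, mem_filter]
    exact ⟨fun h' => ⟨⟨⟨h'.1, h.ne_of_adj _ _ h'.2.1⟩, h'.2.2⟩, h'.2.1⟩,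
      fun h' => ⟨h'.1.1.1, h'.2, h'.1.2⟩⟩
  have h2 := card_filter_add_card_filter_not
    (s := (distinctClassPairs c J).filter fun e => p e.1 = p e.2) fun e => G.Adj e.1 e.2
  have h3 := card_filter_add_card_filter_not
    (s := (distinctClassPairs c J).filter fun e => ¬ G.Adj e.1 e.2) fun e => p e.1 = p e.2
  have h4 : ((distinctClassPairs c J).filter fun e => ¬ G.Adj e.1 e.2).filter
      (fun e => p e.1 = p e.2) =
      ((distinctClassPairs c J).filter fun e => p e.1 = p e.2).filter fun e => ¬ G.Adj e.1 e.2 :=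
    filter_comm _ _ _
  have h5 : ((distinctClassPairs c J).filter fun e => ¬ G.Adj e.1 e.2).filter
      (fun e => ¬ p e.1 = p e.2) =
      (distinctClassPairs c J).filter fun e => ¬ G.Adj e.1 e.2 ∧ p e.1 ≠ p e.2 := by
    rw [filter_filter]
  rw [h4, h5] at h3
  rw [h1]
  omega

theorem card_filter_same_class_le (h : BalancedDense G c r m) (J : Finset (Fin ℓ)) :
    #((classUnion c J ×ˢ classUnion c J).filter fun e => c e.1 = c e.2) ≤ #J * m ^ 2 := by
  rw [card_eq_sum_card_fiberwise (f := fun e : V × V => c e.1) (t := J)]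
  · rw [← smul_eq_mul, ← sum_const]
    refine sum_le_sum fun i _ => ?_
    rw [pow_two, ← h.card_class i, ← card_product]
    refine card_le_card fun e he => ?_
    simp only [mem_filter, mem_product, mem_univ, true_and] at he ⊢
    exact ⟨he.2, he.1.2 ▸ he.2⟩
  · intro e he
    simp only [classUnion, coe_filter, mem_filter, mem_product, mem_univ, true_and,
      Set.mem_ofPred_eq] at he
    exact he.1.1

theorem sum_card_color_sq_eq (J : Finset (Fin ℓ)) (p : V → Fin r) :
    ∑ s, #((classUnion c J).filter fun x => p x = s) ^ 2 =
      #((classUnion c J ×ˢ classUnion c J).filter fun e => p e.1 = p e.2) := by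
  rw [card_eq_sum_card_fiberwise (f := fun e : V × V => p e.1) (t := univ)
    (fun _ _ => mem_coe.2 (mem_univ _))]
  refine sum_congr rfl fun s _ => ?_
  rw [pow_two, ← card_product]
  congr 1
  ext e
  simp only [mem_filter, mem_product]
  exact ⟨fun h => ⟨⟨⟨h.1.1, h.2.1⟩, h.1.2.trans h.2.2.symm⟩, h.1.2⟩,
    fun h => ⟨⟨h.1.1.1, h.2⟩, h.1.1.2, h.1.2 ▸ h.2⟩⟩

theorem sum_card_color_sq_le (h : BalancedDense G c r m) (J : Finset (Fin ℓ)) (p : V → Fin r) :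
    ∑ s, #((classUnion c J).filter fun x => p x = s) ^ 2 ≤
      #((distinctClassPairs c J).filter fun e => p e.1 = p e.2) + #J * m ^ 2 := by
  rw [sum_card_color_sq_eq, ← card_filter_add_card_filter_not
    (s := (classUnion c J ×ˢ classUnion c J).filter fun e => p e.1 = p e.2)
    fun e => c e.1 ≠ c e.2]
  refine add_le_add (card_le_card fun e he => ?_)
    (le_trans (card_le_card fun e he => ?_) (h.card_filter_same_class_le J))
  · simp only [distinctClassPairs, mem_filter] at he ⊢
    tauto
  · simp only [mem_filter, not_not] at he ⊢
    tauto

theorem sum_card_color (h : BalancedDense G c r m) (J : Finset (Fin ℓ)) (p : V → Fin r) :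
    ∑ s, (#((classUnion c J).filter fun x => p x = s) : ℝ) = #J * m := by
  rw [← Nat.cast_sum, ← card_eq_sum_card_fiberwise (fun _ _ => mem_coe.2 (mem_univ _)),
    h.card_classUnion J]
  push_cast
  rfl

/-- Since the colour classes have nearly the least possible sum of squares, each of them contains
nearly a proportion `1 / r` of the vertices. -/
theorem card_color_ge (h : BalancedDense G c r m) (hr : 0 < r) (J : Finset (Fin ℓ))
    (p : V → Fin r) {a : ℝ} (ha : 0 ≤ a)
    (hin : #J * (m : ℝ) ^ 2 + #(innerPairs G p (classUnion c J)) ≤ a ^ 2) (s : Fin r) :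
    (#J * m : ℝ) / r - a ≤ #((classUnion c J).filter fun x => p x = s) := by
  set S : Fin r → ℝ := fun s => (#((classUnion c J).filter fun x => p x = s) : ℝ) with hS
  have hr0 : (0 : ℝ) < r := by exact_mod_cast hr
  have h1 : ∑ s, S s = #J * m := h.sum_card_color J p
  have h2 : ∑ s, S s ^ 2 ≤
      #((distinctClassPairs c J).filter fun e => p e.1 = p e.2) + #J * (m : ℝ) ^ 2 := by
    have := (Nat.cast_le (α := ℝ)).2 (h.sum_card_color_sq_le J p)
    push_cast at this
    exact this
  have h3 := congrArg (Nat.cast (R := ℝ)) (h.card_same_add_card_cross J p)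
  push_cast at h3
  have h4 := h.card_nonadj_distinctClassPairs_le J
  have h5 : (#((distinctClassPairs c J).filter fun e => ¬ G.Adj e.1 e.2) : ℝ) ≤
      (#J * m : ℝ) ^ 2 / r := by
    rw [le_div_iff₀ hr0]
    have : 0 ≤ #J * (m : ℝ) ^ 2 := by positivity
    nlinarith
  have h6 : ∑ s, (S s - (#J * m : ℝ) / r) ^ 2 ≤ a ^ 2 := by
    have : ∑ s, (S s - (#J * m : ℝ) / r) ^ 2 = ∑ s, S s ^ 2 - (#J * m : ℝ) ^ 2 / r := by
      simp only [sub_sq, sum_add_distrib, sum_sub_distrib]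
      rw [← sum_mul, ← mul_sum, h1, sum_const, card_univ, Fintype.card_fin, nsmul_eq_mul]
      field_simp
      ring
    rw [this]
    have h7 : (0 : ℝ) ≤
      #((distinctClassPairs c J).filter fun e => ¬ G.Adj e.1 e.2 ∧ p e.1 ≠ p e.2) := by positivity
    linarith
  have h7 : (S s - (#J * m : ℝ) / r) ^ 2 ≤ a ^ 2 :=
    (single_le_sum (f := fun s => (S s - (#J * m : ℝ) / r) ^ 2)
      (fun _ _ => sq_nonneg _) (mem_univ s)).trans h6
  have h8 := (abs_le_of_sq_le_sq' h7 ha).1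
  change _ ≤ S s
  linarith

/-- Call a vertex bad if it misses about half of some colour class other than its own. Adjacent
vertices of equal colour cannot both be good, so the number `B` of bad vertices bounds the number
of such pairs from above, and at the same time the number of missing pairs from below. -/
theorem exists_card_bad_bound (h : BalancedDense G c r m) {t L : ℕ} {b a₀ a : ℝ}
    (hs : BlowupScale r t L b a₀) (hfree : ¬ (completePlus r t).IsContained G) (ha : a₀ ≤ a)
    (J : Finset (Fin ℓ)) (p : V → Fin r)
    (hmiss : (#(missingPairs G p (classUnion c J)) : ℝ) ≤ a ^ 2)
    (hin : #J * (m : ℝ) ^ 2 + #(innerPairs G p (classUnion c J)) ≤ a ^ 2)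
    (hdeg : ∀ u, (#((classUnion c J).filter fun x => p x = p u ∧ G.Adj u x) : ℝ) ≤ a)
    (hsize : 6 * r * a ≤ #J * m) :
    ∃ B : ℕ, (#(innerPairs G p (classUnion c J)) : ℝ) ≤ 2 * B * a ∧
      B * ((#J * m : ℝ) / (2 * r) - a - m) ≤
        #((distinctClassPairs c J).filter fun e => ¬ G.Adj e.1 e.2 ∧ p e.1 ≠ p e.2) := by
  set U := classUnion c J with hU
  have hr0 : (0 : ℝ) < r := by
    have := hs.two_le_r
    exact_mod_cast (by omega : 0 < r)
  have ha0 : 0 < a := hs.a₀_pos.trans_le ha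
  have hS := h.card_color_ge (by exact_mod_cast hr0) J p ha0.le hin
  set S : Fin r → ℝ := fun s => (#(U.filter fun x => p x = s) : ℝ) with hSdef
  have hNr : 6 * a ≤ (#J * m : ℝ) / r := by
    rw [le_div_iff₀ hr0]
    linarith
  set B := U.filter fun u => ∃ s ≠ p u,
    (#(U.filter fun x => p x = s ∧ G.Adj u x) : ℝ) < S s / 2 + a / 2 with hB
  have hgood : ∀ u ∈ U, ∀ v ∈ U, u ∉ B → v ∉ B → p u = p v → ¬ G.Adj u v := by
    intro u hu v hv huB hvB huv
    have hu' : ∀ s ≠ p u, S s / 2 + a / 2 ≤ #(U.filter fun x => p x = s ∧ G.Adj u x) := by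
      intro s hsu
      by_contra hlt
      exact huB (mem_filter.2 ⟨hu, s, hsu, not_le.1 hlt⟩)
    have hv' : ∀ s ≠ p u, S s / 2 + a / 2 ≤ #(U.filter fun x => p x = s ∧ G.Adj v x) := by
      intro s hsu
      by_contra hlt
      exact hvB (mem_filter.2 ⟨hv, s, huv ▸ hsu, not_le.1 hlt⟩)
    refine not_adj_of_card_common_ge G hs hfree ha p U hmiss u v (p u) ?_ ?_
    · have := hS (p u)
      linarith
    · intro s hsu
      have h1 := card_union_add_card_inter (U.filter fun x => p x = s ∧ G.Adj u x)
        (U.filter fun x => p x = s ∧ G.Adj v x)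
      have h2 : #((U.filter fun x => p x = s ∧ G.Adj u x) ∪
          U.filter fun x => p x = s ∧ G.Adj v x) ≤ #(U.filter fun x => p x = s) := by
        refine card_le_card fun x hx => ?_
        simp only [mem_union, mem_filter] at hx ⊢
        tauto
      have h3 : (U.filter fun x => p x = s ∧ G.Adj u x) ∩
          (U.filter fun x => p x = s ∧ G.Adj v x) =
          U.filter fun x => p x = s ∧ G.Adj u x ∧ G.Adj v x := by
        ext x
        simp only [mem_inter, mem_filter]
        tauto
      rw [h3] at h1
      have h4 : (#(U.filter fun x => p x = s ∧ G.Adj u x) : ℝ) +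
          #(U.filter fun x => p x = s ∧ G.Adj v x) ≤
          S s + #(U.filter fun x => p x = s ∧ G.Adj u x ∧ G.Adj v x) := by
        have : #(U.filter fun x => p x = s ∧ G.Adj u x) +
          #(U.filter fun x => p x = s ∧ G.Adj v x) ≤ #(U.filter fun x => p x = s) +
            #(U.filter fun x => p x = s ∧ G.Adj u x ∧ G.Adj v x) := by omega
        have := (Nat.cast_le (α := ℝ)).2 this
        push_cast at this
        exact this
      linarith [hu' s hsu, hv' s hsu]
  refine ⟨#B, ?_, ?_⟩
  · have hsub : innerPairs G p U ⊆
        (B.sigma fun u => U.filter fun x => p x = p u ∧ G.Adj u x).image (fun z => (z.1, z.2)) ∪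
        (B.sigma fun u => U.filter fun x => p x = p u ∧ G.Adj u x).image fun z => (z.2, z.1) := by
      rintro ⟨u, v⟩ he
      simp only [innerPairs, mem_filter, mem_product] at he
      obtain ⟨⟨hu, hv⟩, hadj, hp⟩ := he
      by_cases huB : u ∈ B
      · refine mem_union_left _ (mem_image.2 ⟨⟨u, v⟩, mem_sigma.2 ⟨huB, ?_⟩, rfl⟩)
        exact mem_filter.2 ⟨hv, hp.symm, hadj⟩
      · by_cases hvB : v ∈ B
        · refine mem_union_right _ (mem_image.2 ⟨⟨v, u⟩, mem_sigma.2 ⟨hvB, ?_⟩, rfl⟩)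
          exact mem_filter.2 ⟨hu, hp, hadj.symm⟩
        · exact absurd hadj (hgood u hu v hv huB hvB hp)
    have h1 : #(innerPairs G p U) ≤
        2 * ∑ u ∈ B, #(U.filter fun x => p x = p u ∧ G.Adj u x) := by
      refine (card_le_card hsub).trans ((card_union_le _ _).trans ?_)
      rw [two_mul, ← card_sigma]
      exact add_le_add card_image_le card_image_le
    have h2 : (∑ u ∈ B, (#(U.filter fun x => p x = p u ∧ G.Adj u x) : ℝ)) ≤ ∑ u ∈ B, a :=
      sum_le_sum fun u _ => hdeg u
    rw [sum_const, nsmul_eq_mul] at h2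
    have h3 : (#(innerPairs G p U) : ℝ) ≤
        2 * ∑ u ∈ B, (#(U.filter fun x => p x = p u ∧ G.Adj u x) : ℝ) := by exact_mod_cast h1
    linarith
  · have h1 : ∀ u ∈ B, (#J * m : ℝ) / (2 * r) - a - m ≤
        #(U.filter fun x => c u ≠ c x ∧ ¬ G.Adj u x ∧ p u ≠ p x) := by
      intro u hu
      obtain ⟨-, s, hsu, hlt⟩ := mem_filter.1 hu
      have h2 : #(U.filter fun x => p x = s) ≤ #(U.filter fun x => p x = s ∧ G.Adj u x) +
          #(U.filter fun x => c u ≠ c x ∧ ¬ G.Adj u x ∧ p u ≠ p x) + m := by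
        rw [← h.card_class (c u)]
        refine le_trans (card_le_card (t := ((U.filter fun x => p x = s ∧ G.Adj u x) ∪
          (U.filter fun x => c u ≠ c x ∧ ¬ G.Adj u x ∧ p u ≠ p x)) ∪
          univ.filter fun v => c v = c u) fun x hx => ?_)
          ((card_union_le _ _).trans (add_le_add_left (card_union_le _ _) _))
        obtain ⟨hxU, hxs⟩ := mem_filter.1 hx
        simp only [mem_union, mem_filter, mem_univ, true_and]
        by_cases h3 : c x = c u
        · exact Or.inr h3
        · by_cases h4 : G.Adj u x
          · exact Or.inl (Or.inl ⟨hxU, hxs, h4⟩)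
          · exact Or.inl (Or.inr ⟨hxU, Ne.symm h3, h4, by rw [hxs]; exact hsu.symm⟩)
      have h3 := (Nat.cast_le (α := ℝ)).2 h2
      push_cast at h3
      have h4 := hS s
      have h5 : (#J * m : ℝ) / (2 * r) = (#J * m : ℝ) / r / 2 := by
        field_simp
      rw [h5]
      linarith
    have h2 := sum_le_sum h1
    rw [sum_const, nsmul_eq_mul] at h2
    refine h2.trans ?_
    have h3 : ∑ u ∈ B, #(U.filter fun x => c u ≠ c x ∧ ¬ G.Adj u x ∧ p u ≠ p x) ≤
        #((distinctClassPairs c J).filter fun e => ¬ G.Adj e.1 e.2 ∧ p e.1 ≠ p e.2) := by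
      rw [← card_sigma]
      refine card_le_card_of_injOn (fun z => (z.1, z.2)) ?_ ?_
      · rintro ⟨u, x⟩ hz
        simp only [coe_sigma, Set.mem_sigma_iff, mem_coe, mem_filter] at hz
        simp only [distinctClassPairs, coe_filter, mem_filter, mem_product, Set.mem_ofPred_eq]
        exact ⟨⟨⟨(mem_filter.1 hz.1).1, hz.2.1⟩, hz.2.2.1⟩, hz.2.2.2⟩
      · rintro ⟨u, x⟩ - ⟨u', x'⟩ - h
        simp only [Prod.mk.injEq] at h
        obtain ⟨rfl, rfl⟩ := h
        rfl
    exact_mod_cast h3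

end BalancedDense

/-! ### Chebyshev's inequality and the extremal family -/

theorem Monovary.mul_sub_nonneg {ι : Type*} {f g : ι → ℝ} (h : Monovary f g) (s t : ι) :
    0 ≤ (f s - f t) * (g s - g t) := by
  rcases lt_trichotomy (g s) (g t) with hg | hg | hg
  · exact mul_nonneg_of_nonpos_of_nonpos (sub_nonpos.2 (h hg)) (sub_nonpos.2 hg.le)
  · simp [hg]
  · exact mul_nonneg (sub_nonneg.2 (h hg)) (sub_nonneg.2 hg.le)

theorem sum_sum_sub_mul_sub {ι : Type*} [Fintype ι] (f g : ι → ℝ) :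
    ∑ s, ∑ t, (f s - f t) * (g s - g t) =
      2 * (Fintype.card ι * ∑ s, f s * g s - (∑ s, f s) * ∑ s, g s) := by
  have h : ∀ s t, (f s - f t) * (g s - g t) = f s * g s + f t * g t - (f s * g t + g s * f t) :=
    fun s t => by ring
  simp only [h, sum_sub_distrib, sum_add_distrib, sum_const, card_univ, nsmul_eq_mul, ← mul_sum,
    ← sum_mul]
  ring

theorem Monovary.sum_mul_sum_le_card_mul {ι : Type*} [Fintype ι] {f g : ι → ℝ}
    (h : Monovary f g) :
    (∑ s, f s) * ∑ s, g s ≤ Fintype.card ι * ∑ s, f s * g s := by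
  have h1 : 0 ≤ ∑ s, ∑ t, (f s - f t) * (g s - g t) :=
    sum_nonneg fun s _ => sum_nonneg fun t _ => h.mul_sub_nonneg s t
  rw [sum_sum_sub_mul_sub] at h1
  linarith

/-- The equality case of Chebyshev's sum inequality. -/
theorem Monovary.const_or_const_of_card_mul_sum_le {ι : Type*} [Fintype ι] {f g : ι → ℝ}
    (h : Monovary f g) (hle : Fintype.card ι * ∑ s, f s * g s ≤ (∑ s, f s) * ∑ s, g s) :
    (∀ s t, f s = f t) ∨ ∀ s t, g s = g t := by
  have h1 : ∑ s, ∑ t, (f s - f t) * (g s - g t) = 0 := by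
    refine le_antisymm ?_ (sum_nonneg fun s _ => sum_nonneg fun t _ => h.mul_sub_nonneg s t)
    rw [sum_sum_sub_mul_sub]
    linarith
  have h2 : ∀ s t, (f s - f t) * (g s - g t) = 0 := fun s t =>
    (sum_eq_zero_iff_of_nonneg fun t _ => h.mul_sub_nonneg s t).1
      ((sum_eq_zero_iff_of_nonneg fun s _ => sum_nonneg fun t _ => h.mul_sub_nonneg s t).1 h1 s
        (mem_univ s)) t (mem_univ t)
  by_contra! hne
  obtain ⟨⟨s, t, hf⟩, u, v, hg⟩ := hne
  have h3 : ∀ w, g w = g s := by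
    intro w
    have hst : g s = g t := by
      rcases mul_eq_zero.1 (h2 s t) with h | h
      · exact absurd (sub_eq_zero.1 h) hf
      · exact sub_eq_zero.1 h
    rcases mul_eq_zero.1 (h2 w s) with h | h
    · rcases mul_eq_zero.1 (h2 w t) with h' | h'
      · exact absurd ((sub_eq_zero.1 h).symm.trans (sub_eq_zero.1 h')) hf
      · exact (sub_eq_zero.1 h').trans hst.symm
    · exact sub_eq_zero.1 h
  exact hg ((h3 u).trans (h3 v).symm)

theorem monovary_of_antitone_comp {r : ℕ} {f g : Fin r → ℕ} (σ : Equiv.Perm (Fin r))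
    (hf : Antitone (f ∘ σ)) (hg : Antitone (g ∘ σ)) :
    Monovary (fun s => (f s : ℝ)) fun s => (g s : ℝ) := by
  intro s t hst
  have hst : g s < g t := Nat.cast_lt.1 hst
  obtain ⟨s, rfl⟩ := σ.surjective s
  obtain ⟨t, rfl⟩ := σ.surjective t
  have : t ≤ s := by
    by_contra hlt
    exact absurd (hg (le_of_lt (not_le.1 hlt))) (not_le.2 hst)
  exact Nat.cast_le.2 (hf this)

theorem exists_perm_antitone {r : ℕ} (f : Fin r → ℕ) :
    ∃ σ : Equiv.Perm (Fin r), Antitone (f ∘ σ) :=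
  ⟨Tuple.sort (OrderDual.toDual ∘ f), fun _ _ h =>
    Tuple.monotone_sort (OrderDual.toDual ∘ f) h⟩

/-- The number of vertices of colour `s` in the class `i`. -/
noncomputable def colorProfile {ℓ r : ℕ} (c : V → Fin ℓ) (p : V → Fin r) (i : Fin ℓ)
    (s : Fin r) : ℕ :=
  #(univ.filter fun v => c v = i ∧ p v = s)

namespace BalancedDense

variable {G : SimpleGraph V} {ℓ : ℕ} {c : V → Fin ℓ} {r m : ℕ}

theorem sum_colorProfile (h : BalancedDense G c r m) (p : V → Fin r) (i : Fin ℓ) :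
    ∑ s, colorProfile c p i s = m := by
  rw [← h.card_class i, card_eq_sum_card_fiberwise (f := p) (t := univ)
    (fun _ _ => mem_coe.2 (mem_univ _))]
  simp only [colorProfile, filter_filter]

theorem card_same_color_eq (p : V → Fin r) (i j : Fin ℓ) :
    #(univ.filter fun e : V × V => (c e.1 = i ∧ c e.2 = j) ∧ p e.1 = p e.2) =
      ∑ s, colorProfile c p i s * colorProfile c p j s := by
  rw [card_eq_sum_card_fiberwise (f := fun e : V × V => p e.1) (t := univ)
    (fun _ _ => mem_coe.2 (mem_univ _))]
  refine sum_congr rfl fun s _ => ?_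
  rw [colorProfile, colorProfile, ← card_product]
  congr 1
  ext e
  simp only [mem_filter, mem_product, mem_univ, true_and]
  exact ⟨fun h => ⟨⟨h.1.1.1, h.2⟩, h.1.1.2, h.1.2 ▸ h.2⟩,
    fun h => ⟨⟨⟨h.1.1, h.2.1⟩, h.1.2.trans h.2.2.symm⟩, h.1.2⟩⟩

/-- Two classes whose colour sizes are sorted by the same permutation meet in at least `m ^ 2 / r`
pairs of equal colour, by Chebyshev's sum inequality; if all these pairs are non-adjacent, the
density condition forces equality. -/
theorem const_or_const_of_proper (h : BalancedDense G c r m) (p : V → Fin r) {i j : Fin ℓ}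
    (hij : i ≠ j) (σ : Equiv.Perm (Fin r)) (hi : Antitone (colorProfile c p i ∘ σ))
    (hj : Antitone (colorProfile c p j ∘ σ))
    (hp : ∀ u v, c u = i → c v = j → p u = p v → ¬ G.Adj u v) :
    (∀ s t, colorProfile c p i s = colorProfile c p i t) ∨
      ∀ s t, colorProfile c p j s = colorProfile c p j t := by
  have h1 : r * ∑ s, colorProfile c p i s * colorProfile c p j s ≤ m ^ 2 := by
    rw [← card_same_color_eq]
    refine le_trans (Nat.mul_le_mul_left _ (card_le_card fun e he => ?_)) (h.card_nonadj_le i j hij)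
    simp only [mem_filter, mem_univ, true_and] at he ⊢
    exact ⟨he.1, hp _ _ he.1.1 he.1.2 he.2⟩
  have h2 := (monovary_of_antitone_comp σ hi hj).const_or_const_of_card_mul_sum_le (by
    rw [Fintype.card_fin, ← Nat.cast_sum, ← Nat.cast_sum, h.sum_colorProfile p i,
      h.sum_colorProfile p j]
    have := (Nat.cast_le (α := ℝ)).2 h1
    push_cast at this
    rw [← pow_two]
    exact this)
  exact_mod_cast h2

/-- If one of two classes is split evenly, the pairs of equal colour already use up all the
non-adjacent pairs allowed by the density condition. -/
theorem adj_of_const (h : BalancedDense G c r m) (p : V → Fin r) {i j : Fin ℓ} (hij : i ≠ j)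
    (hi : ∀ s t, colorProfile c p i s = colorProfile c p i t)
    (hp : ∀ u v, c u = i → c v = j → p u = p v → ¬ G.Adj u v) {u v : V} (hu : c u = i)
    (hv : c v = j) (huv : p u ≠ p v) : G.Adj u v := by
  by_contra hadj
  have hm : r * colorProfile c p i (p u) = m := by
    rw [← h.sum_colorProfile p i, sum_congr rfl fun s _ => hi s (p u), sum_const, card_univ,
      Fintype.card_fin, smul_eq_mul]
  have h1 : r * ∑ s, colorProfile c p i s * colorProfile c p j s = m ^ 2 := by
    rw [sum_congr rfl fun s _ => by rw [hi s (p u)], ← mul_sum, h.sum_colorProfile p j, ← mul_assoc,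
      hm, pow_two]
  have h2 := h.card_nonadj_le i j hij
  have h3 : #(univ.filter fun e : V × V => (c e.1 = i ∧ c e.2 = j) ∧ p e.1 = p e.2) <
      #(univ.filter fun e : V × V => (c e.1 = i ∧ c e.2 = j) ∧ ¬ G.Adj e.1 e.2) := by
    refine card_lt_card ((ssubset_iff_of_subset fun e he => ?_).2 ⟨(u, v), ?_, ?_⟩)
    · simp only [mem_filter, mem_univ, true_and] at he ⊢
      exact ⟨he.1, hp _ _ he.1.1 he.1.2 he.2⟩
    · simp [hu, hv, hadj]
    · simp [huv]
  rw [card_same_color_eq] at h3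
  have hr : 0 < r := (p u).pos
  have := Nat.mul_lt_mul_of_pos_left h3 hr
  omega

end BalancedDense

/-- A properly `(k - 1)`-colourable graph with the required densities is extremal: the classes
that are not split evenly by the colouring have distinct sorting permutations. -/
theorem isoToExtremal_of_proper {G : SimpleGraph V} {k ℓ m : ℕ} {c : V → Fin ℓ}
    (h : BalancedDense G c (k - 1) m) (hm : 0 < m) (hfac : (k - 1).factorial ≤ ℓ)
    (p : V → Fin (k - 1)) (hp : ∀ u v, G.Adj u v → p u ≠ p v) : IsoToExtremal k ℓ G := by
  set w := colorProfile c p with hw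
  have hprop : ∀ i j, ∀ u v, c u = i → c v = j → p u = p v → ¬ G.Adj u v :=
    fun _ _ u v _ _ huv hadj => hp u v hadj huv
  choose σ hσ using fun i => exists_perm_antitone (w i)
  set NC : Finset (Fin ℓ) := univ.filter fun i => ¬ ∀ s t, w i s = w i t with hNC
  have hinj : Set.InjOn σ NC := by
    intro i hi j hj hij
    by_contra hne
    rcases h.const_or_const_of_proper p hne (σ i) (hσ i) (hij ▸ hσ j) (hprop i j) with h1 | h1
    · exact (mem_filter.1 hi).2 h1
    · exact (mem_filter.1 hj).2 h1
  let π₀ : Equiv.Perm (Fin (k - 1)) ≃ Fin (k - 1).factorial :=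
    Fintype.equivFinOfCardEq (by rw [Fintype.card_perm, Fintype.card_fin])
  let g : Fin ℓ → Fin ℓ := fun i => Fin.castLE hfac (π₀ (σ i))
  obtain ⟨E₀, hE₀⟩ := Finset.exists_equiv_extend_of_card_eq (α := Fin ℓ) (t := univ) (by simp)
    (f := g) (s := NC) (subset_univ _)
    fun i hi j hj hij => hinj hi hj (π₀.injective (Fin.castLE_injective hfac hij))
  let E : Fin ℓ ≃ Fin ℓ := E₀.trans (Equiv.subtypeUnivEquiv fun x => mem_univ x)
  have hE : ∀ i ∈ NC, E i = g i := hE₀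
  -- classes with unequal colour sizes are relabelled into the first `(k - 1)!` places
  have hconst : ∀ i : Fin ℓ, (k - 1).factorial ≤ (E i).val → ∀ s t, w i s = w i t := by
    intro i hi
    by_contra hne
    have h1 := hE i (mem_filter.2 ⟨mem_univ _, hne⟩)
    have h2 : (E i).val < (k - 1).factorial := by
      rw [h1]
      exact (π₀ (σ i)).isLt
    omega
  let size : Fin ℓ → Fin (k - 1) → ℕ := fun i s => w (E.symm i) s
  have hsum : ∀ i, ∑ s, size i s = m := fun i => h.sum_colorProfile p _
  refine ⟨size, ⟨⟨π₀.symm, fun i hi => ?_⟩, fun i hi => ?_, fun i => by rw [hsum]; exact hm⟩, ?_⟩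
  · by_cases hc : ∀ s t, w (E.symm i) s = w (E.symm i) t
    · exact fun s t _ => (hc _ _).le
    · have h1 := hE (E.symm i) (mem_filter.2 ⟨mem_univ _, hc⟩)
      rw [Equiv.apply_symm_apply] at h1
      have h2 : (⟨i.val, hi⟩ : Fin (k - 1).factorial) = π₀ (σ (E.symm i)) :=
        Fin.ext (show i.val = (π₀ (σ (E.symm i))).val from congrArg Fin.val h1)
      rw [h2, Equiv.symm_apply_apply]
      exact hσ (E.symm i)
  · have hc := hconst (E.symm i) (by rwa [Equiv.apply_symm_apply])
    refine ⟨hc, fun s => Nat.pos_of_ne_zero fun h0 => ?_⟩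
    have h1 := hsum i
    rw [sum_congr rfl fun t _ => (hc t s).trans h0] at h1
    simp at h1
    omega
  let f : V → Fin ℓ × Fin (k - 1) := fun v => (E (c v), p v)
  have hcard : ∀ y : Fin ℓ × Fin (k - 1), Fintype.card {v // f v = y} = size y.1 y.2 := by
    intro y
    rw [Fintype.card_subtype]
    simp only [size, hw, colorProfile]
    congr 1
    ext v
    simp only [f, mem_filter, mem_univ, true_and, Prod.ext_iff, Equiv.eq_symm_apply]
  let Φ : ExtremalVertex size ≃ V :=
    (Equiv.sigmaCongrRight fun y => (Fintype.equivFinOfCardEq (hcard y)).symm).trans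
      (Equiv.sigmaFiberEquiv f)
  have hΦ : ∀ x, f (Φ x) = x.1 := fun x =>
    ((Fintype.equivFinOfCardEq (hcard x.1)).symm x.2).2
  have hΦc : ∀ x, E (c (Φ x)) = x.1.1 := fun x => congrArg Prod.fst (hΦ x)
  have hΦp : ∀ x, p (Φ x) = x.1.2 := fun x => congrArg Prod.snd (hΦ x)
  have hadj : ∀ x y, (fullExtremalGraph size).Adj x y → ¬ G.Adj (Φ x) (Φ y) →
      x.1.1.val < (k - 1).factorial := by
    intro x y hxy hnot
    by_contra hlt
    refine hnot (h.adj_of_const p (i := c (Φ x)) (j := c (Φ y)) ?_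
      (hconst _ (by rw [hΦc]; exact not_lt.1 hlt)) (hprop _ _) rfl rfl ?_)
    · intro heq
      exact hxy.1 (by rw [← hΦc x, ← hΦc y, heq])
    · rw [hΦp, hΦp]
      exact hxy.2
  refine ⟨G.comap Φ, ⟨fun x y hxy => ⟨?_, ?_⟩, fun x y hxy hnot => ⟨hadj x y hxy hnot, ?_⟩⟩,
    ⟨(SimpleGraph.Iso.comap Φ G).symm⟩⟩
  · rw [← hΦc x, ← hΦc y]
    exact fun heq => h.ne_of_adj _ _ hxy (E.injective heq)
  · rw [← hΦp x, ← hΦp y]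
    exact hp _ _ hxy
  · exact hadj y x hxy.symm fun h' => hnot h'.symm

/-! ### Proper colourings on sorted and on evenly split classes -/

theorem missingPairs_subset (G : SimpleGraph V) {r : ℕ} (p : V → Fin r) (U : Finset V) :
    missingPairs G p U ⊆ missingPairs G p univ :=
  filter_subset_filter _ (product_subset_product (subset_univ _) (subset_univ _))

theorem innerPairs_subset (G : SimpleGraph V) {r : ℕ} (p : V → Fin r) (U : Finset V) :
    innerPairs G p U ⊆ innerPairs G p univ :=
  filter_subset_filter _ (product_subset_product (subset_univ _) (subset_univ _))

namespace BalancedDense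

variable {G : SimpleGraph V} {ℓ : ℕ} {c : V → Fin ℓ} {r m : ℕ}

theorem card_same_color_ge (h : BalancedDense G c r m) (J : Finset (Fin ℓ)) (p : V → Fin r)
    (σ : Equiv.Perm (Fin r)) (hσ : ∀ i ∈ J, Antitone (colorProfile c p i ∘ σ)) :
    #J * (#J - 1) * (m : ℝ) ^ 2 ≤
      r * #((distinctClassPairs c J).filter fun e => p e.1 = p e.2) := by
  have h1 : #((distinctClassPairs c J).filter fun e => p e.1 = p e.2) =
      ∑ ij ∈ J.offDiag, ∑ s, colorProfile c p ij.1 s * colorProfile c p ij.2 s := by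
    rw [card_eq_sum_card_fiberwise (f := fun e => (c e.1, c e.2)) (t := J.offDiag)]
    · refine sum_congr rfl fun ij hij => ?_
      obtain ⟨hi, hj, hne⟩ := mem_offDiag.1 hij
      rw [← card_same_color_eq]
      congr 1
      ext e
      simp only [distinctClassPairs, classUnion, mem_filter, mem_product, mem_univ, true_and,
        Prod.ext_iff]
      exact ⟨fun h => ⟨h.2, h.1.2⟩, fun h => ⟨⟨⟨⟨h.1.1 ▸ hi, h.1.2 ▸ hj⟩,
        by rw [h.1.1, h.1.2]; exact hne⟩, h.2⟩, h.1⟩⟩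
    · intro e he
      simp only [distinctClassPairs, classUnion, coe_filter, mem_filter, mem_product, mem_univ,
        true_and, Set.mem_ofPred_eq] at he
      simpa using ⟨he.1.1.1, he.1.1.2, he.1.2⟩
  have h2 : ∀ ij ∈ J.offDiag, (m : ℝ) ^ 2 ≤
      r * ∑ s, (colorProfile c p ij.1 s : ℝ) * colorProfile c p ij.2 s := by
    intro ij hij
    obtain ⟨hi, hj, hne⟩ := mem_offDiag.1 hij
    have h3 := (monovary_of_antitone_comp σ (hσ _ hi) (hσ _ hj)).sum_mul_sum_le_card_mul
    rw [Fintype.card_fin, ← Nat.cast_sum, ← Nat.cast_sum, h.sum_colorProfile p,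
      h.sum_colorProfile p, ← pow_two] at h3
    exact h3
  have h3 := sum_le_sum h2
  rw [sum_const, nsmul_eq_mul, offDiag_card, Nat.cast_sub (Nat.le_mul_self _), ← mul_sum] at h3
  rw [h1]
  push_cast at h3 ⊢
  linarith

/-- Among classes whose colour sizes are sorted by the same permutation, the colouring is proper:
Chebyshev's sum inequality leaves no room for missing pairs beyond the adjacent pairs of equal
colour, and hence none for bad vertices. -/
theorem proper_of_antitone (h : BalancedDense G c r m) {t L : ℕ} {b a₀ a : ℝ}
    (hs : BlowupScale r t L b a₀) (hfree : ¬ (completePlus r t).IsContained G) (ha : a₀ ≤ a)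
    (p : V → Fin r) (hmiss : (#(missingPairs G p univ) : ℝ) ≤ a ^ 2)
    (hin : ℓ * (m : ℝ) ^ 2 + #(innerPairs G p univ) ≤ a ^ 2)
    (hdeg : ∀ u, (#(univ.filter fun x => p x = p u ∧ G.Adj u x) : ℝ) ≤ a)
    (J : Finset (Fin ℓ)) (hsize : 6 * r * a ≤ #J * m)
    (hsize' : 3 * a + m < (#J * m : ℝ) / (2 * r)) (σ : Equiv.Perm (Fin r))
    (hσ : ∀ i ∈ J, Antitone (colorProfile c p i ∘ σ)) :
    ∀ u v, c u ∈ J → c v ∈ J → p u = p v → ¬ G.Adj u v := by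
  have hr0 : (0 : ℝ) < r := by
    have := hs.two_le_r
    exact_mod_cast (by omega : 0 < r)
  have hJℓ : (#J : ℝ) ≤ ℓ := by
    have := card_le_univ J
    rw [Fintype.card_fin] at this
    exact_mod_cast this
  obtain ⟨B, hB1, hB2⟩ := h.exists_card_bad_bound hs hfree ha J p
    (le_trans (Nat.cast_le.2 (card_le_card (missingPairs_subset G p _))) hmiss)
    (le_trans (add_le_add (mul_le_mul_of_nonneg_right hJℓ (sq_nonneg _))
      (Nat.cast_le.2 (card_le_card (innerPairs_subset G p _)))) hin)
    (fun u => le_trans (Nat.cast_le.2 (card_le_card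
      (filter_subset_filter _ (subset_univ _)))) (hdeg u)) hsize
  have h1 := congrArg (Nat.cast (R := ℝ)) (h.card_same_add_card_cross J p)
  push_cast at h1
  have h2 := h.card_nonadj_distinctClassPairs_le J
  have h3 := h.card_same_color_ge J p σ hσ
  have h4 : (#((distinctClassPairs c J).filter fun e => ¬ G.Adj e.1 e.2) : ℝ) ≤
      #((distinctClassPairs c J).filter fun e => p e.1 = p e.2) :=
    le_of_mul_le_mul_left (h2.trans h3) hr0
  have hB : B = 0 := by
    by_contra hne
    have hBpos : (0 : ℝ) < B := by exact_mod_cast Nat.pos_of_ne_zero hne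
    have : (B : ℝ) * ((#J * m : ℝ) / (2 * r) - 3 * a - m) ≤ 0 := by linarith
    have h5 : 0 < (B : ℝ) * ((#J * m : ℝ) / (2 * r) - 3 * a - m) := mul_pos hBpos (by linarith)
    linarith
  rw [hB] at hB1
  have hempty : #(innerPairs G p (classUnion c J)) = 0 := by
    have : (#(innerPairs G p (classUnion c J)) : ℝ) ≤ 0 := by simpa using hB1
    exact_mod_cast le_antisymm this (Nat.cast_nonneg _)
  rw [card_eq_zero] at hempty
  intro u v hu hv hp hadj
  have : (u, v) ∈ innerPairs G p (classUnion c J) := by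
    simp [innerPairs, classUnion, hu, hv, hp, hadj]
  rw [hempty] at this
  simp at this

theorem exists_const_classes (h : BalancedDense G c r m) (p : V → Fin r) (J : Finset (Fin ℓ))
    (hp : ∀ u v, c u ∈ J → c v ∈ J → p u = p v → ¬ G.Adj u v) (σ : Equiv.Perm (Fin r))
    (hσ : ∀ i ∈ J, Antitone (colorProfile c p i ∘ σ)) :
    ∃ J' ⊆ J, #J ≤ #J' + 1 ∧
      ∀ i ∈ J', ∀ s t, colorProfile c p i s = colorProfile c p i t := by
  refine ⟨J.filter fun i => ∀ s t, colorProfile c p i s = colorProfile c p i t,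
    filter_subset _ _, ?_, fun i hi => (mem_filter.1 hi).2⟩
  rw [← card_filter_add_card_filter_not (s := J)
    fun i => ∀ s t, colorProfile c p i s = colorProfile c p i t]
  refine Nat.add_le_add_left (card_le_one.2 fun i hi j hj => ?_) _
  obtain ⟨hiJ, hi⟩ := mem_filter.1 hi
  obtain ⟨hjJ, hj⟩ := mem_filter.1 hj
  by_contra hij
  rcases h.const_or_const_of_proper p hij σ (hσ i hiJ) (hσ j hjJ)
    (fun u v hu hv => hp u v (hu ▸ hiJ) (hv ▸ hjJ)) with h1 | h1
  · exact hi h1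
  · exact hj h1

theorem card_color_classUnion_of_const (h : BalancedDense G c r m) (p : V → Fin r)
    (J : Finset (Fin ℓ)) (hJ : ∀ i ∈ J, ∀ s t, colorProfile c p i s = colorProfile c p i t)
    (s : Fin r) : r * #((classUnion c J).filter fun x => p x = s) = #J * m := by
  have hmaps : Set.MapsTo c ((classUnion c J).filter fun x => p x = s) J :=
    fun x hx => (mem_filter.1 (mem_filter.1 hx).1).2
  rw [card_eq_sum_card_fiberwise hmaps, mul_sum, ← smul_eq_mul (a := #J), ← sum_const]
  refine sum_congr rfl fun i hi => ?_
  rw [← h.sum_colorProfile p i, sum_congr rfl fun t _ => hJ i hi t s, sum_const, card_univ,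
    Fintype.card_fin, smul_eq_mul, colorProfile]
  congr 2
  ext x
  simp only [classUnion, mem_filter, mem_univ, true_and]
  exact ⟨fun h => ⟨h.2, h.1.2⟩, fun h => ⟨⟨h.1 ▸ hi, h.2⟩, h.1⟩⟩

theorem sum_card_nonadj_le (h : BalancedDense G c r m) {i : Fin ℓ} {J : Finset (Fin ℓ)}
    (hi : i ∉ J) :
    ∑ v ∈ univ.filter (fun v => c v = i), r * #((classUnion c J).filter fun x => ¬ G.Adj v x) ≤
      m * (#J * m) := by
  rw [← mul_sum, ← card_sigma]
  have hmaps : Set.MapsTo (fun z : (_ : V) × V => c z.2)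
      ((univ.filter (fun v => c v = i)).sigma fun v =>
        (classUnion c J).filter fun x => ¬ G.Adj v x) J := by
    rintro ⟨v, x⟩ hz
    exact (mem_filter.1 (mem_filter.1 (mem_sigma.1 hz).2).1).2
  rw [card_eq_sum_card_fiberwise hmaps, mul_sum]
  calc _ ≤ ∑ j ∈ J, m ^ 2 := ?_
    _ = _ := by rw [sum_const, smul_eq_mul]; ring
  refine sum_le_sum fun j hj => le_trans (Nat.mul_le_mul_left _ ?_)
    (h.card_nonadj_le i j fun hij => hi (hij ▸ hj))
  refine card_le_card_of_injOn (fun z => (z.1, z.2)) ?_ ?_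
  · rintro ⟨v, x⟩ hz
    simp only [coe_filter, mem_sigma, mem_filter, mem_univ, true_and, Set.mem_ofPred_eq] at hz ⊢
    exact ⟨⟨hz.1.1, hz.2⟩, hz.1.2.2⟩
  · rintro ⟨v, x⟩ - ⟨v', x'⟩ - hz
    simp only [Prod.mk.injEq] at hz
    obtain ⟨rfl, rfl⟩ := hz
    rfl

/-- A colouring that is proper on a large union of evenly split classes is proper everywhere: each
vertex outside must be joined to exactly the vertices of the other colours there. -/
theorem proper_of_const_classes (h : BalancedDense G c r m) {t L : ℕ} {b a₀ a : ℝ}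
    (hs : BlowupScale r t L b a₀) (hfree : ¬ (completePlus r t).IsContained G) (ha : a₀ ≤ a)
    (p : V → Fin r) (hmiss : (#(missingPairs G p univ) : ℝ) ≤ a ^ 2)
    (hdeg : ∀ u, (#(univ.filter fun x => p x = p u ∧ G.Adj u x) : ℝ) ≤ a)
    (J : Finset (Fin ℓ)) (hJ : ∀ i ∈ J, ∀ s t, colorProfile c p i s = colorProfile c p i t)
    (hp : ∀ u v, c u ∈ J → c v ∈ J → p u = p v → ¬ G.Adj u v)
    (hsize : 2 * a + 2 * m < (#J * m : ℝ) / r) :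
    ∀ u v, G.Adj u v → p u ≠ p v := by
  have hr0 : (0 : ℝ) < r := by
    have := hs.two_le_r
    exact_mod_cast (by omega : 0 < r)
  have ha0 : 0 < a := hs.a₀_pos.trans_le ha
  set U := classUnion c J with hU
  have hmissU : (#(missingPairs G p U) : ℝ) ≤ a ^ 2 :=
    le_trans (Nat.cast_le.2 (card_le_card (missingPairs_subset G p _))) hmiss
  have hQ : ∀ s, (#(U.filter fun x => p x = s) : ℝ) = (#J * m : ℝ) / r := by
    intro s
    rw [eq_div_iff hr0.ne', mul_comm]
    exact_mod_cast h.card_color_classUnion_of_const p J hJ s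
  have hm0 : (0 : ℝ) ≤ m := Nat.cast_nonneg m
  have hJadj : ∀ u ∈ U, ∀ v ∈ U, c u ≠ c v → p u ≠ p v → G.Adj u v := by
    intro u hu v hv huv hpuv
    have hu := (mem_filter.1 hu).2
    have hv := (mem_filter.1 hv).2
    exact h.adj_of_const p huv (hJ _ hu)
      (fun x y hx hy => hp x y (hx ▸ hu) (hy ▸ hv)) rfl rfl hpuv
  -- A vertex outside these classes misses at least as many vertices of `U` as the density allows
  -- on average, so equality holds for each of them.
  have hlower : ∀ v, c v ∉ J → (#J * m : ℝ) / r ≤ #(U.filter fun x => ¬ G.Adj v x) ∧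
      ((∃ x ∈ U, p x ≠ p v ∧ ¬ G.Adj v x) →
        (#J * m : ℝ) / r < #(U.filter fun x => ¬ G.Adj v x)) := by
    intro v hv
    by_cases hgood : ∀ s ≠ p v, a + m ≤ #(U.filter fun x => p x = s ∧ G.Adj v x)
    · have hno : ∀ x ∈ U, p x = p v → ¬ G.Adj v x := by
        intro x hx hpx
        refine not_adj_of_card_common_ge G hs hfree ha p U hmissU v x (p v) ?_ ?_
        · rw [hQ]
          linarith
        · intro s hsv
          have h1 : #(U.filter fun y => p y = s ∧ G.Adj v y) ≤
              #(U.filter fun y => p y = s ∧ G.Adj v y ∧ G.Adj x y) + m := by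
            rw [← h.card_class (c x)]
            refine (card_le_card fun y hy => ?_).trans (card_union_le _ _)
            simp only [mem_union, mem_filter, mem_univ, true_and] at hy ⊢
            by_cases hxy : c y = c x
            · exact Or.inr hxy
            · exact Or.inl ⟨hy.1, hy.2.1, hy.2.2, hJadj x hx y hy.1 (Ne.symm hxy)
                (by rw [hpx, hy.2.1]; exact hsv.symm)⟩
          have h2 := (Nat.cast_le (α := ℝ)).2 h1
          push_cast at h2
          linarith [hgood s hsv]
      have hsub : U.filter (fun x => p x = p v) ⊆ U.filter fun x => ¬ G.Adj v x := by
        intro x hx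
        obtain ⟨h1, h2⟩ := mem_filter.1 hx
        exact mem_filter.2 ⟨h1, hno x h1 h2⟩
      rw [← hQ (p v)]
      refine ⟨Nat.cast_le.2 (card_le_card hsub), ?_⟩
      rintro ⟨x, hxU, hpx, hx⟩
      refine Nat.cast_lt.2 (card_lt_card ((ssubset_iff_of_subset hsub).2
        ⟨x, mem_filter.2 ⟨hxU, hx⟩, fun h' => hpx (mem_filter.1 h').2⟩))
    · push Not at hgood
      obtain ⟨s, hsv, hlt⟩ := hgood
      have h1 : #(U.filter fun x => p x = p v) + #(U.filter fun x => p x = s) ≤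
          #(U.filter fun x => ¬ G.Adj v x) + #(univ.filter fun x => p x = p v ∧ G.Adj v x) +
            #(U.filter fun x => p x = s ∧ G.Adj v x) := by
        rw [← card_union_of_disjoint]
        · refine (card_le_card fun x hx => ?_).trans
            ((card_union_le _ _).trans (Nat.add_le_add_right (card_union_le _ _) _))
          simp only [mem_union, mem_filter, mem_univ, true_and] at hx ⊢
          tauto
        · rw [disjoint_left]
          intro x hx hx'
          exact hsv ((mem_filter.1 hx').2.symm.trans (mem_filter.1 hx).2)
      have h2 := (Nat.cast_le (α := ℝ)).2 h1
      push_cast at h2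
      rw [hQ, hQ] at h2
      have h3 := hdeg v
      have h4 : (#J * m : ℝ) / r < #(U.filter fun x => ¬ G.Adj v x) := by linarith
      exact ⟨h4.le, fun _ => h4⟩
  have houter : ∀ v, c v ∉ J → ∀ x ∈ U, p x ≠ p v → G.Adj v x := by
    intro v hv x hx hpx
    by_contra hadj
    have h1 := (Nat.cast_le (α := ℝ)).2 (h.sum_card_nonadj_le hv)
    push_cast at h1
    have h2 : ∑ w ∈ univ.filter (fun w => c w = c v), (#J * m : ℝ) <
        ∑ w ∈ univ.filter (fun w => c w = c v), r * (#(U.filter fun x => ¬ G.Adj w x) : ℝ) := by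
      refine sum_lt_sum (fun w hw => ?_) ⟨v, by simp, ?_⟩
      · have := (hlower w (by rw [(mem_filter.1 hw).2]; exact hv)).1
        rw [div_le_iff₀ hr0] at this
        linarith
      · have := (hlower v hv).2 ⟨x, hx, hpx, hadj⟩
        rw [div_lt_iff₀ hr0] at this
        linarith
    rw [sum_const, nsmul_eq_mul, h.card_class] at h2
    linarith
  have hall : ∀ v, ∀ x ∈ U, c x ≠ c v → p x ≠ p v → G.Adj v x := by
    intro v x hx hcx hpx
    by_cases hv : c v ∈ J
    · exact hJadj v (mem_filter.2 ⟨mem_univ _, hv⟩) x hx hcx.symm hpx.symm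
    · exact houter v hv x hx hpx
  intro u v hadj hpuv
  refine not_adj_of_card_common_ge G hs hfree ha p U hmissU u v (p u) ?_ ?_ hadj
  · rw [hQ]
    linarith
  · intro s hsu
    have h1 : #(U.filter fun y => p y = s) ≤
        #(U.filter fun y => p y = s ∧ G.Adj u y ∧ G.Adj v y) +
          #(univ.filter fun y => c y = c u) + #(univ.filter fun y => c y = c v) := by
      refine (card_le_card fun y hy => ?_).trans
        ((card_union_le _ _).trans (Nat.add_le_add_right (card_union_le _ _) _))
      simp only [mem_union, mem_filter, mem_univ, true_and] at hy ⊢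
      by_cases hyu : c y = c u
      · exact Or.inl (Or.inr hyu)
      · by_cases hyv : c y = c v
        · exact Or.inr hyv
        · exact Or.inl (Or.inl ⟨hy.1, hy.2, hall u y hy.1 hyu (by rw [hy.2]; exact hsu),
            hall v y hy.1 hyv (by rw [hy.2, ← hpuv]; exact hsu)⟩)
    rw [h.card_class, h.card_class] at h1
    have h2 := (Nat.cast_le (α := ℝ)).2 h1
    push_cast at h2
    rw [hQ] at h2
    linarith

end BalancedDense

/-! ### Existence of a proper colouring -/

theorem card_cliqueTuples_le_of_not_isContained (G : SimpleGraph V) {r t L : ℕ} {b a₀ : ℝ}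
    (hs : BlowupScale r t L b a₀) (hfree : ¬ (completePlus r t).IsContained G)
    (hV : a₀ ≤ Fintype.card V) :
    (#(cliqueTuples G (r + 1)) : ℝ) ≤ 2 * (r + 1) * b * (Fintype.card V : ℝ) ^ (r + 1) := by
  by_contra! hlt
  have h2 := hs.two_le_t
  have hr := hs.two_le_r
  obtain ⟨T, -, hT, hadj⟩ := exists_completeParts G hs.b_pos (L := L) (t := t) (q := r + 1)
    (by omega) (by omega) hs.t_le (fun _ => univ)
    (fun _ => hs.L_le.trans (mul_le_mul_of_nonneg_left hV hs.b_pos.le)) (by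
      rw [prod_const, card_univ, card_univ, Fintype.card_fin, Fintype.piFinset_univ]
      push_cast
      exact hlt.le)
  obtain ⟨v, hv⟩ : (T (Fin.last r)).Nonempty := card_pos.1 (by rw [hT]; omega)
  exact hfree (completePlus_isContained_of_vertex_adj G (by omega) h2 (fun i => T i.castSucc)
    (fun i => hT _) (fun i j hij => hadj _ _ fun h => hij (Fin.castSucc_injective _ h))
    (fun i x hx => hadj _ _ (Fin.castSucc_lt_last i).ne' v hv x hx))

namespace BalancedDense

variable {G : SimpleGraph V} {ℓ : ℕ} {c : V → Fin ℓ} {r m : ℕ}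

theorem classUnion_univ : classUnion c univ = univ := by
  simp [classUnion]

theorem card_eq (h : BalancedDense G c r m) : Fintype.card V = ℓ * m := by
  have := h.card_classUnion univ
  rwa [classUnion_univ, card_univ, card_univ, Fintype.card_fin] at this

theorem card_cliqueTuples_two_ge (h : BalancedDense G c r m) (hr : 0 < r) (hℓ : 0 < ℓ) :
    (1 - 1 / r - 1 / ℓ) * (Fintype.card V : ℝ) ^ 2 ≤ #(cliqueTuples G 2) := by
  have hr0 : (0 : ℝ) < r := by exact_mod_cast hr
  have hℓ0 : (0 : ℝ) < ℓ := by exact_mod_cast hℓ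
  have h1 : #(univ.filter fun e : V × V => G.Adj e.1 e.2) ≤ #(cliqueTuples G 2) := by
    refine card_le_card_of_injOn (fun e => ![e.1, e.2]) ?_ ?_
    · intro e he
      simp only [coe_filter, mem_univ, true_and, Set.mem_ofPred_eq] at he
      simp only [mem_coe, mem_cliqueTuples, Fin.forall_fin_two]
      simp [he, he.symm]
    · intro e _ e' _ hee
      exact Prod.ext (congrFun hee 0) (congrFun hee 1)
  have h2 := card_filter_add_card_filter_not (s := (univ : Finset (V × V)))
    fun e => G.Adj e.1 e.2
  rw [card_univ, Fintype.card_prod] at h2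
  have h3 : #(univ.filter fun e : V × V => ¬ G.Adj e.1 e.2) ≤
      #((distinctClassPairs c univ).filter fun e => ¬ G.Adj e.1 e.2) + ℓ * m ^ 2 := by
    have h4 := h.card_filter_same_class_le univ
    rw [card_univ, Fintype.card_fin] at h4
    refine le_trans (card_le_card fun e he => ?_)
      ((card_union_le _ _).trans (Nat.add_le_add_left h4 _))
    simp only [distinctClassPairs, classUnion_univ, mem_union, mem_filter, mem_product, mem_univ,
      true_and] at he ⊢
    tauto
  have h4 := h.card_nonadj_distinctClassPairs_le univ
  rw [card_univ, Fintype.card_fin] at h4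
  have h5 := (Nat.cast_le (α := ℝ)).2 h1
  have h6 := (Nat.cast_le (α := ℝ)).2 h3
  have h7 := congrArg (Nat.cast (R := ℝ)) h2
  push_cast at h6 h7
  have hn : (Fintype.card V : ℝ) = ℓ * m := by exact_mod_cast h.card_eq
  rw [hn] at h7 ⊢
  have h8 : (#((distinctClassPairs c univ).filter fun e => ¬ G.Adj e.1 e.2) : ℝ) ≤
      (ℓ * m : ℝ) ^ 2 / r := by
    rw [le_div_iff₀ hr0]
    have : 0 ≤ (ℓ : ℝ) * (m : ℝ) ^ 2 := by positivity
    linarith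
  have h9 : (1 - 1 / (r : ℝ) - 1 / ℓ) * (ℓ * m : ℝ) ^ 2 =
      (ℓ * m : ℝ) * (ℓ * m) - (ℓ * m : ℝ) ^ 2 / r - ℓ * m ^ 2 := by
    field_simp
  rw [h9]
  linarith

theorem card_cross_le (h : BalancedDense G c r m) (hr : 0 < r) (p : V → Fin r) :
    (#((distinctClassPairs c univ).filter fun e => ¬ G.Adj e.1 e.2 ∧ p e.1 ≠ p e.2) : ℝ) ≤
      #(innerPairs G p univ) + ℓ * (m : ℝ) ^ 2 := by
  have hr0 : (0 : ℝ) < r := by exact_mod_cast hr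
  have h1 := congrArg (Nat.cast (R := ℝ)) (h.card_same_add_card_cross univ p)
  have h2 := h.card_nonadj_distinctClassPairs_le univ
  have h3 := (Nat.cast_le (α := ℝ)).2 (h.sum_card_color_sq_le univ p)
  have h4 := h.sum_card_color univ p
  rw [classUnion_univ] at h1 h3 h4
  rw [card_univ, Fintype.card_fin] at h2 h3 h4
  push_cast at h1 h3
  have h5 := sq_sum_le_card_mul_sum_sq (s := (univ : Finset (Fin r)))
    (f := fun s => (#(univ.filter fun x => p x = s) : ℝ))
  rw [h4, card_univ, Fintype.card_fin] at h5
  have h6 := mul_le_mul_of_nonneg_left h3 hr0.le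
  have h7 : (r : ℝ) * #((distinctClassPairs c univ).filter fun e => ¬ G.Adj e.1 e.2) ≤
      r * (#((distinctClassPairs c univ).filter fun e => p e.1 = p e.2) + ℓ * (m : ℝ) ^ 2) := by
    have : 0 ≤ (ℓ : ℝ) * (m : ℝ) ^ 2 := by positivity
    linarith
  have h8 := le_of_mul_le_mul_left h7 hr0
  linarith

theorem card_missingPairs_le (h : BalancedDense G c r m) (hr : 0 < r) (p : V → Fin r) :
    (#(missingPairs G p univ) : ℝ) ≤ #(innerPairs G p univ) + 2 * (ℓ * (m : ℝ) ^ 2) := by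
  have h1 := h.card_cross_le hr p
  have h2 : #(missingPairs G p univ) ≤
      #((distinctClassPairs c univ).filter fun e => ¬ G.Adj e.1 e.2 ∧ p e.1 ≠ p e.2) +
        ℓ * m ^ 2 := by
    have h4 := h.card_filter_same_class_le univ
    rw [card_univ, Fintype.card_fin] at h4
    refine le_trans (card_le_card fun e he => ?_)
      ((card_union_le _ _).trans (Nat.add_le_add_left h4 _))
    simp only [missingPairs, distinctClassPairs, classUnion_univ, mem_union, mem_filter,
      mem_product, mem_univ, true_and] at he ⊢
    tauto
  have h3 := (Nat.cast_le (α := ℝ)).2 h2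
  push_cast at h3
  linarith

/-- Summing the density condition over all pairs of classes leaves only `O(m)` bad vertices, which
improves the number of adjacent pairs of equal colour from a small constant proportion of all
pairs to a proportion of order `1 / ℓ`. -/
theorem card_innerPairs_le (h : BalancedDense G c r m) {t L : ℕ} {b a₀ : ℝ}
    (hs : BlowupScale r t L b a₀) (hfree : ¬ (completePlus r t).IsContained G)
    (ha : a₀ ≤ (ℓ * m : ℝ) / (12 * r)) (p : V → Fin r)
    (hmiss : (#(missingPairs G p univ) : ℝ) ≤ ((ℓ * m : ℝ) / (12 * r)) ^ 2)
    (hin : ℓ * (m : ℝ) ^ 2 + #(innerPairs G p univ) ≤ ((ℓ * m : ℝ) / (12 * r)) ^ 2)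
    (hdeg : ∀ u, (#(univ.filter fun x => p x = p u ∧ G.Adj u x) : ℝ) ≤ (ℓ * m : ℝ) / (12 * r))
    (hℓ : 8 * (r : ℝ) ≤ ℓ) :
    (#(innerPairs G p univ) : ℝ) ≤ 4 / 3 * (ℓ * (m : ℝ) ^ 2) := by
  have hr : 0 < r := by have := hs.two_le_r; omega
  have hr0 : (0 : ℝ) < r := by exact_mod_cast hr
  set a : ℝ := (ℓ * m : ℝ) / (12 * r) with hadef
  have hn0 : (0 : ℝ) ≤ ℓ * m := by positivity
  obtain ⟨B, hB1, hB2⟩ := h.exists_card_bad_bound hs hfree ha univ p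
    (by rwa [classUnion_univ]) (by rwa [classUnion_univ, card_univ, Fintype.card_fin])
    (by rwa [classUnion_univ]) (by
      rw [card_univ, Fintype.card_fin, hadef]
      have : 6 * r * ((ℓ * m : ℝ) / (12 * r)) = (ℓ * m : ℝ) / 2 := by
        field_simp
        ring
      rw [this]
      linarith)
  rw [classUnion_univ] at hB1
  rw [card_univ, Fintype.card_fin] at hB2
  have h1 := h.card_cross_le hr p
  have h2 : (ℓ * m : ℝ) / (8 * r) ≤ (ℓ * m : ℝ) / (2 * r) - 3 * a - m := by
    have h3 : (m : ℝ) ≤ (ℓ * m : ℝ) / (8 * r) := by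
      rw [le_div_iff₀ (by positivity), mul_comm]
      exact mul_le_mul_of_nonneg_right hℓ (Nat.cast_nonneg m)
    have h4 : (ℓ * m : ℝ) / (2 * r) - 3 * a = 2 * ((ℓ * m : ℝ) / (8 * r)) := by
      rw [hadef]
      field_simp
      ring
    linarith
  have h5 := mul_le_mul_of_nonneg_left h2 (Nat.cast_nonneg (α := ℝ) B)
  have h6 : (B : ℝ) * ((ℓ * m : ℝ) / (8 * r)) ≤ ℓ * (m : ℝ) ^ 2 := by linarith
  have h7 : 2 * (B : ℝ) * a = 4 / 3 * (B * ((ℓ * m : ℝ) / (8 * r))) := by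
    rw [hadef]
    field_simp
    ring
  linarith

/-- With an error of order `1 / ℓ` one may pass to the classes sharing a sorting permutation,
which make up a proportion of at least `1 / r!` of all classes. -/
theorem proper_of_card_innerPairs_le (h : BalancedDense G c r m) (hm : 0 < m) {t L : ℕ} {b : ℝ}
    (hs : BlowupScale r t L b (2 * m * √ℓ)) (hfree : ¬ (completePlus r t).IsContained G)
    (hℓ : 1000 * (r : ℝ) ^ 2 * r.factorial ≤ √ℓ) (p : V → Fin r)
    (hpdeg : ∀ v s, #(univ.filter fun x => p x = p v ∧ G.Adj v x) ≤
      #(univ.filter fun x => p x = s ∧ G.Adj v x))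
    (hin : (#(innerPairs G p univ) : ℝ) ≤ 4 / 3 * (ℓ * (m : ℝ) ^ 2)) :
    ∀ u v, G.Adj u v → p u ≠ p v := by
  have hr2 : (2 : ℝ) ≤ r := by exact_mod_cast hs.two_le_r
  have hr : 0 < r := by have := hs.two_le_r; omega
  have hr0 : (0 : ℝ) < r := by linarith
  have hm1 : (1 : ℝ) ≤ m := by exact_mod_cast hm
  have hfac1 : (1 : ℝ) ≤ r.factorial := by exact_mod_cast Nat.factorial_pos r
  set w : ℝ := √ℓ with hw
  have hw2 : w ^ 2 = ℓ := Real.sq_sqrt (Nat.cast_nonneg ℓ)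
  have hwr : 1000 * (r : ℝ) ^ 2 ≤ w := le_trans (le_mul_of_one_le_right (by positivity) hfac1) hℓ
  have hw1 : 4000 ≤ w := by nlinarith
  have hmw : (0 : ℝ) < m * w := by positivity
  have hm2 : 0 ≤ ℓ * (m : ℝ) ^ 2 := by positivity
  have hmiss := h.card_missingPairs_le hr p
  set a₁ : ℝ := 2 * m * w with ha₁
  have ha₁sq : a₁ ^ 2 = 4 * (ℓ * (m : ℝ) ^ 2) := by rw [ha₁, ← hw2]; ring
  have hmiss₁ : (#(missingPairs G p univ) : ℝ) ≤ a₁ ^ 2 := by rw [ha₁sq]; linarith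
  have hdeg₁ : ∀ u, (#(univ.filter fun x => p x = p u ∧ G.Adj u x) : ℝ) ≤ a₁ := by
    intro u
    obtain ⟨s, hs'⟩ := exists_color_card_lt G hs hfree le_rfl p univ hmiss₁ u
    exact (Nat.cast_le.2 (hpdeg u s)).trans hs'.le
  choose σ hσ using fun i => exists_perm_antitone (colorProfile c p i)
  obtain ⟨τ, hτ⟩ := Fintype.exists_le_card_fiber_of_nsmul_le_card (M := ℝ) (f := σ)
    (b := ℓ / r.factorial) (by
      rw [Fintype.card_perm, Fintype.card_fin, Fintype.card_fin, nsmul_eq_mul]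
      exact le_of_eq (mul_div_cancel₀ _ (by positivity)))
  set J := univ.filter fun i => σ i = τ with hJ
  have hJσ : ∀ i ∈ J, Antitone (colorProfile c p i ∘ τ) := fun i hi =>
    (mem_filter.1 hi).2 ▸ hσ i
  have hJcard : 1000 * (r : ℝ) ^ 2 * w ≤ #J := by
    refine le_trans ?_ hτ
    rw [le_div_iff₀ (by positivity), ← hw2]
    calc 1000 * (r : ℝ) ^ 2 * w * r.factorial = 1000 * (r : ℝ) ^ 2 * r.factorial * w := by ring
      _ ≤ w * w := by gcongr
      _ = w ^ 2 := (pow_two w).symm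
  have hJr : 1000 * w ≤ (#J : ℝ) / r := by
    rw [le_div_iff₀ hr0]
    have : w * r ≤ w * r ^ 2 := by
      gcongr
      nlinarith
    linarith
  have hJm : 1000 * (m * w) ≤ (#J * m : ℝ) / r := by
    have := mul_le_mul_of_nonneg_right hJr (Nat.cast_nonneg (α := ℝ) m)
    calc 1000 * (m * w) = 1000 * w * m := by ring
      _ ≤ (#J : ℝ) / r * m := this
      _ = _ := by ring
  have hmmw : (m : ℝ) ≤ m * w := le_mul_of_one_le_right (by linarith) (by linarith)
  have hproper := h.proper_of_antitone hs hfree le_rfl p hmiss₁ (by rw [ha₁sq]; linarith) hdeg₁ J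
    (by
      rw [le_div_iff₀ hr0] at hJm
      have : 0 ≤ m * w * r := by positivity
      rw [ha₁]
      linarith)
    (by
      have : (#J * m : ℝ) / (2 * r) = (#J * m : ℝ) / r / 2 := by field_simp
      rw [this, ha₁]
      linarith) τ hJσ
  obtain ⟨J', hJ'J, hJ'card, hJ'⟩ := h.exists_const_classes p J hproper τ hJσ
  refine h.proper_of_const_classes hs hfree le_rfl p hmiss₁ hdeg₁ J' hJ'
    (fun u v hu hv => hproper u v (hJ'J hu) (hJ'J hv)) ?_
  have h1 : (#J : ℝ) ≤ #J' + 1 := by exact_mod_cast hJ'card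
  have h2 : (#J * m : ℝ) / r ≤ (#J' * m : ℝ) / r + m := by
    rw [div_add' _ _ _ hr0.ne']
    gcongr
    nlinarith
  rw [ha₁]
  linarith

/-- The hypothesis `hb` makes the inner pairs of the stability colouring, together with the pairs
lost inside the classes, fewer than the square of `n / (12 * r)`, the threshold at which the first
count of bad vertices succeeds. -/
theorem exists_proper_coloring (h : BalancedDense G c r m) (hm : 0 < m) {t L : ℕ} {b : ℝ}
    (hs : BlowupScale r t L b (2 * m * √ℓ)) (hfree : ¬ (completePlus r t).IsContained G)
    (hℓ : 1000 * (r : ℝ) ^ 2 * r.factorial ≤ √ℓ)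
    (hb : 1000 * (r : ℝ) ^ 3 * ((r + 1) * b) * (r : ℝ) ^ r ≤ r.factorial) :
    ∃ p : V → Fin r, ∀ u v, G.Adj u v → p u ≠ p v := by
  have hr2 : (2 : ℝ) ≤ r := by exact_mod_cast hs.two_le_r
  have hr : 0 < r := by have := hs.two_le_r; omega
  have hr0 : (0 : ℝ) < r := by linarith
  have hm1 : (1 : ℝ) ≤ m := by exact_mod_cast hm
  have hfac1 : (1 : ℝ) ≤ r.factorial := by exact_mod_cast Nat.factorial_pos r
  set w : ℝ := √ℓ with hw
  have hw2 : w ^ 2 = ℓ := Real.sq_sqrt (Nat.cast_nonneg ℓ)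
  have hwr : 1000 * (r : ℝ) ^ 2 ≤ w := le_trans (le_mul_of_one_le_right (by positivity) hfac1) hℓ
  have hw1 : 4000 ≤ w := by nlinarith
  have hℓ0 : (0 : ℝ) < ℓ := by rw [← hw2]; positivity
  have hℓpos : 0 < ℓ := by exact_mod_cast hℓ0
  have hℓr : 1000000 * (r : ℝ) ^ 4 ≤ ℓ := by
    rw [← hw2]
    nlinarith [sq_nonneg (r : ℝ)]
  have hn : (Fintype.card V : ℝ) = ℓ * m := by exact_mod_cast h.card_eq
  have hn0 : (0 : ℝ) < ℓ * m := by positivity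
  have hVpos : 0 < Fintype.card V := by
    have : (0 : ℝ) < Fintype.card V := by rw [hn]; exact hn0
    exact_mod_cast this
  have hnw : (ℓ * m : ℝ) = m * w * w := by rw [← hw2]; ring
  have hmw : (0 : ℝ) < m * w := by positivity
  obtain ⟨f, hf⟩ := exists_coloring_card_innerPairs_le G (r := r) (η := 1 / ℓ)
    (γ := 2 * (r + 1) * b) (by positivity) hs.two_le_r
    (by
      rw [mul_one_div, div_le_iff₀ hℓ0]
      nlinarith [pow_pos hr0 3])
    hVpos (h.card_cliqueTuples_two_ge hr hℓpos)
    (card_cliqueTuples_le_of_not_isContained G hs hfree (by rw [hn, hnw]; nlinarith))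
  obtain ⟨p, hpmin, hpdeg⟩ := exists_minimal_coloring G hr
  set I : ℝ := (#(innerPairs G p univ) : ℝ) with hI
  have hb0 := hs.b_pos
  have hI1 : I ≤ (1 / (150 * r ^ 2) + 2 * r ^ 2 * (1 / ℓ)) * (ℓ * m : ℝ) ^ 2 := by
    rw [hn] at hf
    refine (Nat.cast_le.2 (hpmin f)).trans (hf.trans ?_)
    gcongr
    rw [le_div_iff₀ (by positivity)]
    have hfac0 : (0 : ℝ) < r.factorial := by linarith
    have : 3 * r * (2 * (r + 1) * b) * (10 / 9) * ((r : ℝ) ^ r / r.factorial) * (150 * r ^ 2) =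
        (1000 * (r : ℝ) ^ 3 * ((r + 1) * b) * (r : ℝ) ^ r) / r.factorial := by
      field_simp
      ring
    rw [this]
    exact div_le_one_of_le₀ hb hfac0.le
  set a : ℝ := (ℓ * m : ℝ) / (12 * r) with ha
  have haw : 2 * m * w ≤ a := by
    rw [ha, hnw, le_div_iff₀ (by positivity)]
    nlinarith
  have hIa : I + 2 * (ℓ * (m : ℝ) ^ 2) ≤ a ^ 2 := by
    have h1 : 2 * (ℓ * (m : ℝ) ^ 2) = 2 * (1 / ℓ) * (ℓ * m : ℝ) ^ 2 := by field_simp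
    have h2 : a ^ 2 = 1 / (144 * r ^ 2) * (ℓ * m : ℝ) ^ 2 := by
      rw [ha]
      field_simp
      norm_num
    have h3 : 1 / (150 * (r : ℝ) ^ 2) + 2 * r ^ 2 * (1 / ℓ) + 2 * (1 / ℓ) ≤ 1 / (144 * r ^ 2) := by
      have h4 : (1 : ℝ) / ℓ ≤ 1 / (1000000 * (r : ℝ) ^ 4) :=
        one_div_le_one_div_of_le (by positivity) hℓr
      have h5 : (2 * (r : ℝ) ^ 2 + 2) * (1 / ℓ) ≤ (4 * r ^ 2) * (1 / (1000000 * (r : ℝ) ^ 4)) := by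
        gcongr
        nlinarith
      have h6 : (4 * (r : ℝ) ^ 2) * (1 / (1000000 * (r : ℝ) ^ 4)) = 1 / 250000 * (1 / r ^ 2) := by
        field_simp
        norm_num
      have h7 : 1 / (150 * (r : ℝ) ^ 2) = 1 / 150 * (1 / r ^ 2) := by field_simp
      have h8 : 1 / (144 * (r : ℝ) ^ 2) = 1 / 144 * (1 / r ^ 2) := by field_simp
      have h9 : 0 < 1 / (r : ℝ) ^ 2 := by positivity
      rw [h7, h8]
      linarith
    rw [h1, h2]
    have := mul_le_mul_of_nonneg_right h3 (sq_nonneg (ℓ * m : ℝ))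
    linarith
  have hdeg : ∀ a' : ℝ, 2 * m * w ≤ a' → (#(missingPairs G p univ) : ℝ) ≤ a' ^ 2 → ∀ u,
      (#(univ.filter fun x => p x = p u ∧ G.Adj u x) : ℝ) ≤ a' := by
    intro a' ha' hmiss u
    obtain ⟨s, hs'⟩ := exists_color_card_lt G hs hfree ha' p univ hmiss u
    exact (Nat.cast_le.2 (hpdeg u s)).trans hs'.le
  have hmiss := h.card_missingPairs_le hr p
  have hm2 : 0 ≤ ℓ * (m : ℝ) ^ 2 := by positivity
  -- the colouring is correct up to a proportion `O(1 / ℓ)` of all pairs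
  have hI2 : I ≤ 4 / 3 * (ℓ * (m : ℝ) ^ 2) := by
    have hmissa := hmiss.trans hIa
    exact h.card_innerPairs_le hs hfree haw p hmissa (by linarith) (hdeg a haw hmissa)
      (by nlinarith)
  exact ⟨p, h.proper_of_card_innerPairs_le hm hs hfree hℓ p hpdeg hI2⟩

end BalancedDense

/-! ### Densities and numerical estimates -/

theorem balancedDense_of_edgeDensity {G : SimpleGraph V} [DecidableRel G.Adj] {r ℓ m : ℕ}
    (hr : 0 < r) (hm : 0 < m) (C : G.Coloring (Fin ℓ)) (hC : ∀ i, #(vertexClass C i) = m)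
    (hd : ∀ i j : Fin ℓ, i ≠ j →
      ((r : ℚ) - 1) / r ≤ G.edgeDensity (vertexClass C i) (vertexClass C j)) :
    BalancedDense G C r m where
  ne_of_adj u v huv := C.valid huv
  card_class i := by
    rw [← hC i, vertexClass]
  card_nonadj_le i j hij := by
    have h1 := hd i j hij
    have hr0 : (0 : ℚ) < r := by exact_mod_cast hr
    have hm0 : (0 : ℚ) < m := by exact_mod_cast hm
    rw [SimpleGraph.edgeDensity_def, hC, hC, div_le_div_iff₀ hr0 (by positivity)] at h1
    have h2 := card_filter_add_card_filter_not (s := vertexClass C i ×ˢ vertexClass C j)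
      fun e => G.Adj e.1 e.2
    have e1 : (vertexClass C i ×ˢ vertexClass C j).filter (fun e => G.Adj e.1 e.2) =
        G.interedges (vertexClass C i) (vertexClass C j) := by
      ext e
      simp [SimpleGraph.mem_interedges_iff, and_assoc]
    have e2 : (vertexClass C i ×ˢ vertexClass C j).filter (fun e => ¬ G.Adj e.1 e.2) =
        univ.filter fun e : V × V => (C e.1 = i ∧ C e.2 = j) ∧ ¬ G.Adj e.1 e.2 := by
      ext e
      simp [vertexClass]
    rw [e1, e2, card_product, hC, hC] at h2
    have h3 := congrArg (Nat.cast (R := ℚ)) h2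
    push_cast at h3
    have h4 : (r : ℚ) * #(univ.filter fun e : V × V =>
        (C e.1 = i ∧ C e.2 = j) ∧ ¬ G.Adj e.1 e.2) ≤ (m : ℚ) ^ 2 := by
      nlinarith
    have h5 : r * #(univ.filter fun e : V × V =>
        (C e.1 = i ∧ C e.2 = j) ∧ ¬ G.Adj e.1 e.2) ≤ m ^ 2 := by exact_mod_cast h4
    convert h5

/-- The case `r = 2` leaves little room, and `r ≥ 3` follows from `6 * 4 ^ 4 ≥ 1000`. -/
theorem pow_mul_pow_le_factorial_mul_pow {r : ℕ} (hr : 2 ≤ r) :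
    1000 * r ^ 3 * r ^ r ≤ r.factorial * (r + 1) ^ (r + 7) := by
  rcases hr.eq_or_lt with rfl | hr
  · decide
  · have h1 : 6 ≤ r.factorial := by
      have := Nat.factorial_le (show 3 ≤ r from hr)
      simpa [Nat.factorial] using this
    have h2 : 4 ^ 4 ≤ (r + 1) ^ 4 := Nat.pow_le_pow_left (by omega) 4
    calc 1000 * r ^ 3 * r ^ r ≤ (6 * 4 ^ 4) * (r + 1) ^ 3 * (r + 1) ^ r := by
          gcongr
          · norm_num
          · omega
          · omega
      _ ≤ (r.factorial * (r + 1) ^ 4) * (r + 1) ^ 3 * (r + 1) ^ r := by gcongr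
      _ = _ := by ring

/-- The bound only needs `log 4 / 6 ≤ 1 / 4`. -/
theorem natCast_mul_two_pow_le {L : ℕ} {y : ℝ} (hL : (L : ℝ) ≤ y / 6) :
    (L : ℝ) * 2 ^ L ≤ Real.exp (y / 4) := by
  have h1 : (L : ℝ) ≤ 2 ^ L := by exact_mod_cast Nat.lt_two_pow_self.le
  calc (L : ℝ) * 2 ^ L ≤ 2 ^ L * 2 ^ L := by gcongr
    _ = Real.exp (Real.log 2 * (2 * L)) := by
      rw [← Real.rpow_def_of_pos two_pos, two_mul, Real.rpow_add two_pos, Real.rpow_natCast]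
    _ ≤ Real.exp (y / 4) := by
      refine Real.exp_le_exp.2 ?_
      have := Real.log_two_lt_d9
      have hL0 : (0 : ℝ) ≤ L := by positivity
      nlinarith

/-- The choice of parameters: the embedding starts at length `log n / 6` and each of its steps
costs a factor `(r + 1) ^ (r + 8)`; the class size `m` is arbitrary, so that `n = ℓ * m` may be
much larger than `ℓ`. -/
theorem blowupScale_of_exp_le {r ℓ m : ℕ} {X : ℝ} (hr : 2 ≤ r) (hm : 0 < m)
    (hX : X = ((r : ℝ) + 1) ^ ((r + 7) * (r + 1))) (hℓ : Real.exp (4 * X) ≤ ℓ) :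
    BlowupScale r ⌊X⁻¹ / 2 * Real.log (ℓ * m)⌋₊ ⌊Real.log (ℓ * m) / 6⌋₊
      (((r : ℝ) + 1) ^ (r + 8))⁻¹ (2 * m * √ℓ) := by
  have hr2 : (2 : ℝ) ≤ r := by exact_mod_cast hr
  have hm1 : (1 : ℝ) ≤ m := by exact_mod_cast hm
  set k : ℝ := (r : ℝ) + 1 with hk
  have hk3 : 3 ≤ k := by linarith
  have hXb : X = (k ^ (r + 8)) ^ r * k ^ 7 := by
    rw [hX, ← pow_mul, ← pow_add]
    congr 1
    ring
  have hk7 : (3 : ℝ) ^ 7 ≤ k ^ 7 := by gcongr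
  have hbX : k ^ (r + 8) ≤ X := by
    rw [hX]
    refine pow_le_pow_right₀ (by linarith) ?_
    nlinarith
  have hX3 : 3 ≤ X := by
    refine le_trans ?_ hbX
    calc (3 : ℝ) ≤ k := hk3
      _ = k ^ 1 := (pow_one k).symm
      _ ≤ k ^ (r + 8) := pow_le_pow_right₀ (by linarith) (by omega)
  have hX0 : 0 < X := by linarith
  have hℓ0 : (0 : ℝ) < ℓ := (Real.exp_pos _).trans_le hℓ
  set y := Real.log (ℓ * m) with hy
  have hn0 : (0 : ℝ) < ℓ * m := by positivity
  have hy4 : 4 * X ≤ y := by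
    rw [hy, Real.le_log_iff_exp_le hn0]
    exact hℓ.trans (le_mul_of_one_le_right hℓ0.le hm1)
  have hkpos : 0 < k ^ (r + 8) := by positivity
  refine ⟨hr, ?_, by positivity, ?_, ?_, ?_⟩
  · refine Nat.le_floor ?_
    have : X⁻¹ / 2 * (4 * X) = 2 := by
      field_simp
      norm_num
    calc ((2 : ℕ) : ℝ) = X⁻¹ / 2 * (4 * X) := by rw [this]; norm_num
      _ ≤ X⁻¹ / 2 * y := by gcongr
  · rw [← hk, mul_inv_le_iff₀ hkpos, one_mul]
    calc 4 * k ≤ k ^ 2 * k := by gcongr; nlinarith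
      _ = k ^ 3 := by ring
      _ ≤ k ^ (r + 8) := pow_le_pow_right₀ (by linarith) (by omega)
  · have h1 : (⌊X⁻¹ / 2 * y⌋₊ : ℝ) ≤ X⁻¹ / 2 * y :=
      Nat.floor_le (mul_nonneg (by positivity) (by linarith))
    have h2 : y / 12 ≤ (⌊y / 6⌋₊ : ℝ) := by
      have := Nat.lt_floor_add_one (y / 6)
      linarith
    have h3 : (k ^ (r + 8))⁻¹ ^ r = k ^ 7 * X⁻¹ := by
      rw [hXb, mul_inv, inv_pow, mul_comm (k ^ 7), mul_assoc, inv_mul_cancel₀ (by positivity),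
        mul_one]
    rw [h3]
    have h4 : 0 < X⁻¹ := by positivity
    calc (⌊X⁻¹ / 2 * y⌋₊ : ℝ) ≤ X⁻¹ / 2 * y := h1
      _ = 6 * X⁻¹ * (y / 12) := by ring
      _ ≤ k ^ 7 * X⁻¹ * (⌊y / 6⌋₊ : ℝ) := by
        gcongr
        · linarith
        · linarith
  · have h1 := natCast_mul_two_pow_le (Nat.floor_le (show 0 ≤ y / 6 by linarith))
    refine h1.trans ?_
    have h2 : Real.exp (y / 2) ≤ m * √ℓ := by
      rw [← Real.log_le_log_iff (Real.exp_pos _) (by positivity), Real.log_exp,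
        Real.log_mul (by positivity) (by positivity), Real.log_sqrt hℓ0.le, hy,
        Real.log_mul (by positivity) (by positivity)]
      have := Real.log_nonneg hm1
      linarith
    have h3 : k ^ (r + 8) ≤ Real.exp (y / 4) := by
      have := Real.add_one_le_exp X
      have h4 : Real.exp X ≤ Real.exp (y / 4) := Real.exp_le_exp.2 (by linarith)
      linarith
    rw [inv_mul_eq_div, le_div_iff₀ hkpos]
    calc Real.exp (y / 4) * k ^ (r + 8) ≤ Real.exp (y / 4) * Real.exp (y / 4) := by gcongr
      _ = Real.exp (y / 2) := by rw [← Real.exp_add]; ring_nf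
      _ ≤ m * √ℓ := h2
      _ ≤ 2 * m * √ℓ := by
        have : 0 ≤ m * √ℓ := by positivity
        linarith

theorem factorial_mul_le_sqrt {r ℓ : ℕ} {X : ℝ} (hr : 2 ≤ r)
    (hX : X = ((r : ℝ) + 1) ^ ((r + 7) * (r + 1))) (hℓ : Real.exp (4 * X) ≤ ℓ) :
    1000 * (r : ℝ) ^ 2 * r.factorial ≤ √ℓ := by
  have hr2 : (2 : ℝ) ≤ r := by exact_mod_cast hr
  set k : ℝ := (r : ℝ) + 1 with hk
  have hk3 : 3 ≤ k := by linarith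
  have h1 : (r.factorial : ℝ) ≤ k ^ r := by
    have : (r.factorial : ℝ) ≤ (r : ℝ) ^ r := by exact_mod_cast Nat.factorial_le_pow r
    refine this.trans ?_
    gcongr
    linarith
  have h2 : (1000 : ℝ) ≤ k ^ 7 := by
    have : (3 : ℝ) ^ 7 ≤ k ^ 7 := by gcongr
    linarith
  have h3 : 1000 * (r : ℝ) ^ 2 * r.factorial ≤ X := by
    calc 1000 * (r : ℝ) ^ 2 * r.factorial ≤ k ^ 7 * k ^ 2 * k ^ r := by
          gcongr
          linarith
      _ = k ^ (r + 9) := by ring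
      _ ≤ X := by
        rw [hX]
        refine pow_le_pow_right₀ (by linarith) ?_
        nlinarith
  have hX0 : 0 ≤ X := le_trans (by positivity) h3
  refine h3.trans (Real.le_sqrt_of_sq_le (le_trans ?_ hℓ))
  have h4 : X ≤ Real.exp X := by linarith [Real.add_one_le_exp X]
  calc X ^ 2 ≤ Real.exp X ^ 2 := by gcongr
    _ = Real.exp (2 * X) := by rw [← Real.exp_nat_mul]; norm_num
    _ ≤ Real.exp (4 * X) := Real.exp_le_exp.2 (by linarith)

end

theorem mainTheorem4 {V : Type*} [Fintype V] (k ℓ : ℕ) (hk : 3 ≤ k)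
    (hℓ : Real.exp (4 * (k : ℝ) ^ ((k + 6) * k)) ≤ (ℓ : ℝ))
    (G : SimpleGraph V) [DecidableRel G.Adj]
    (C : G.Coloring (Fin ℓ)) (hC : IsBalanced C)
    (hd : ∀ i j : Fin ℓ, i ≠ j →
      ((k : ℚ) - 2) / ((k : ℚ) - 1) ≤ G.edgeDensity (vertexClass C i) (vertexClass C j)) :
    IsoToExtremal k ℓ G ∨
      (completePlus (k - 1)
        ⌊((k : ℝ) ^ ((k + 6) * k))⁻¹ / 2 * Real.log (Fintype.card V : ℝ)⌋₊).IsContained G := by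
  obtain ⟨r, rfl⟩ : ∃ r, k = r + 1 := ⟨k - 1, by omega⟩
  have hr : 2 ≤ r := by omega
  have hr0 : (0 : ℝ) < r := by exact_mod_cast (by omega : 0 < r)
  rw [or_iff_not_imp_right]
  intro hfree
  have hcast : ((r + 1 : ℕ) : ℝ) ^ ((r + 1 + 6) * (r + 1)) =
      ((r : ℝ) + 1) ^ ((r + 7) * (r + 1)) := by
    push_cast
    rfl
  rw [hcast] at hℓ hfree
  have hℓ0 : 0 < ℓ := by exact_mod_cast (Real.exp_pos _).trans_le hℓ
  obtain ⟨m, hm⟩ : ∃ m, ∀ i, (vertexClass C i).card = m :=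
    ⟨(vertexClass C ⟨0, hℓ0⟩).card, fun i => hC.2 i _⟩
  have hmpos : 0 < m := by
    rw [← hm ⟨0, hℓ0⟩]
    exact (hC.1 _).card_pos
  have h : BalancedDense G C r m := balancedDense_of_edgeDensity (by omega) hmpos C hm
    fun i j hij => by
      have := hd i j hij
      push_cast at this
      have h1 : (r : ℚ) + 1 - 2 = r - 1 := by ring
      rwa [h1, add_sub_cancel_right] at this
  have hcard : (Fintype.card V : ℝ) = ℓ * m := by exact_mod_cast h.card_eq
  rw [hcard] at hfree
  have hsqrt := factorial_mul_le_sqrt hr rfl hℓ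
  obtain ⟨p, hp⟩ := h.exists_proper_coloring hmpos (blowupScale_of_exp_le hr hmpos rfl hℓ) hfree
    hsqrt (by
      have h1 : 1000 * (r : ℝ) ^ 3 * (r : ℝ) ^ r ≤ r.factorial * ((r : ℝ) + 1) ^ (r + 7) := by
        exact_mod_cast pow_mul_pow_le_factorial_mul_pow hr
      have h2 : ((r : ℝ) + 1) * (((r : ℝ) + 1) ^ (r + 8))⁻¹ = (((r : ℝ) + 1) ^ (r + 7))⁻¹ := by
        rw [pow_succ' _ (r + 7)]
        field_simp
      rw [h2]
      calc 1000 * (r : ℝ) ^ 3 * (((r : ℝ) + 1) ^ (r + 7))⁻¹ * (r : ℝ) ^ r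
          = 1000 * (r : ℝ) ^ 3 * (r : ℝ) ^ r / ((r : ℝ) + 1) ^ (r + 7) := by
            rw [div_eq_mul_inv]; ring
        _ ≤ (r.factorial : ℝ) := by
          rw [div_le_iff₀ (by positivity)]
          exact h1)
  refine isoToExtremal_of_proper (k := r + 1) h hmpos ?_ p hp
  have h1 : (r.factorial : ℝ) ≤ ℓ := by
    have h2 : (r.factorial : ℝ) ≤ √ℓ := by
      have h3 : (1 : ℝ) ≤ 1000 * (r : ℝ) ^ 2 := by
        have : (2 : ℝ) ≤ r := by exact_mod_cast hr
        nlinarith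
      exact (le_mul_of_one_le_left (Nat.cast_nonneg _) h3).trans hsqrt
    have h3 : (1 : ℝ) ≤ r.factorial := by exact_mod_cast Nat.factorial_pos r
    have h4 : √(ℓ : ℝ) ^ 2 = ℓ := Real.sq_sqrt (Nat.cast_nonneg ℓ)
    nlinarith
  exact_mod_cast h1
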